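/- \textbf{Setting.} Let $\mathcal S$, $\mathcal A$ be finite sets with $S=|\mathcal S|$, $A=|\mathcal A|$, let $\Theta$ be a measurable space of parameters, and for each $\theta\in\Theta$ let $M_\theta=(\mathcal S,\mathcal A,r^\theta,P^\theta)$ be a Markov decision process with rewards $r^\theta(s,a)\in[0,1]$ and transition probabilities $P^\theta(s'|s,a)$, measurable in $\theta$. For a stationary policy $\pi:\mathcal S\to\mathcal A$ let $J_\pi(\theta)=\lim_{T\to\infty}\frac1T\mathbb E[\sum_{t=1}^T r^\theta(s^t,\pi(s^t))]$. Suppose that $J^*(\theta)=\max_\pi J_\pi(\theta)$ does not depend on the initial state and satisfies, with a value function $v(\cdot,\theta)$ measurable in $\theta$, the Bellman equation $$J^*(\theta)+v(s,\theta)=\max_{a\in\mathcal A}\Big\{r^\theta(s,a)+\sum_{s'\in\mathcal S}P^\theta(s'|s,a)\,v(s',\theta)\Big\}\qquad(s\in\mathcal S,\ \theta\in\Theta),$$ and let $\pi^*(s,\theta)$ be a maximizer of the right-hand side, measurable in $\theta$. \textbf{Algorithm (BALSA).} The true parameter $\theta^*$ has prior distribution $\mu^1$; it determines the transitions $s^{t+1}\sim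 P^{\theta^*}(\cdot|s^t,a^t)$ and the rewards $r^t=r^{\theta^*}(s^t,a^t)$, $t=1,2,\dots$. Let $\mu^t$ be the posterior distribution of $\theta^*$ given the history $g^t=(s^1,\dots,s^t,a^1,\dots,a^{t-1},r^1,\dots,r^{t-1})$, and let $M^t(s,a)=|\{\tau<t:(s^\tau,a^\tau)=(s,a)\}|$. BALSA runs in stages $k=1,2,\dots$ with start times $t_1=1$ and $$t_{k+1}=\min\{t>t_k:\ t>t_k+T_{k-1}\ \text{ or }\ M^t(s,a)>2M^{t_k}(s,a)\text{ for some }(s,a)\},$$ where $T_k=t_{k+1}-t_k$ for $k\ge1$ and $T_0=1$. At the start of stage $k$ it draws $\theta_k\sim\mu^{t_k}$, independently of $\theta^*$ given $g^{t_k}$, and it plays $a^t=\pi^*(s^t,\theta_k)$ for $t_k\le t<t_{k+1}$. Its Bayesian regret is $$R(T)=\mathbb E\Big[T J^*(\theta^*)-\sum_{t=1}^T r^{\theta^*}(s^t,a^t)\Big].$$ \textbf{Theorem.} Suppose that $0\le v(s,\theta)\le H$ for all $s\in\mathcal S$ and $\theta\in\Theta$. Then for every integer $T\ge2$ $$R(T)\le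 (H+1)\sqrt{2SAT\log T}+49HS\sqrt{AT\log(AT)}.$$ The right-hand side is $o(T)$ as $T\to\infty$. Moreover $R(T)/T\to0$, that is, the expected average reward per round of BALSA, $\frac1T\mathbb E[\sum_{t=1}^T r^{\theta^*}(s^t,a^t)]$, converges to the optimal one, $\mathbb E[J^*(\theta^*)]$. -/

import Mathlib

open MeasureTheory ProbabilityTheory Filter Topology Asymptotics

noncomputable section

/-- A parameterized Markov decision process with finite state space `S`, action set `A` and
parameter space `Θ`: for each parameter a reward function with values in `[0, 1]` and transition
probabilities, both depending measurably on the parameter. -/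
structure ParamMDP (S A Θ : Type*) [Fintype S] [MeasurableSpace Θ] where
  /-- `reward θ s a` is the reward of action `a` in state `s` under the parameter `θ`. -/
  reward : Θ → S → A → ℝ
  /-- `trans θ s a s'` is the probability to move from `s` to `s'` under `a` and `θ`. -/
  trans : Θ → S → A → S → ℝ
  reward_mem : ∀ θ s a, reward θ s a ∈ Set.Icc (0 : ℝ) 1
  trans_nonneg : ∀ θ s a s', 0 ≤ trans θ s a s'
  trans_sum : ∀ θ s a, ∑ s', trans θ s a s' = 1
  measurable_reward : ∀ s a, Measurable fun θ => reward θ s a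
  measurable_trans : ∀ s a s', Measurable fun θ => trans θ s a s'

namespace ParamMDP

variable {S A Θ : Type*} [Fintype S] [MeasurableSpace Θ]

/-- Expected total reward over `T` rounds of the stationary policy `π` started in state `s`,
when the parameter is `θ` (the first round, followed by the remaining `T - 1` rounds). -/
def totalReward (M : ParamMDP S A Θ) (θ : Θ) (π : S → A) : ℕ → S → ℝ
  | 0, _ => 0
  | T + 1, s =>
      M.reward θ s (π s) + ∑ s', M.trans θ s (π s) s' * M.totalReward θ π T s'

/-- Long-run average reward per round of the stationary policy `π` started in `s`.
(For a finite state space this limit always exists.) -/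
def averageReward (M : ParamMDP S A Θ) (θ : Θ) (π : S → A) (s : S) : ℝ :=
  limUnder atTop fun T : ℕ => M.totalReward θ π T s / (T : ℝ)

/-- Optimal long-run average reward per round from the initial state `s`: the maximum over the
(finitely many) stationary policies. -/
def optAverageReward (M : ParamMDP S A Θ) (θ : Θ) (s : S) : ℝ :=
  ⨆ π : S → A, M.averageReward θ π s

/-- The quantity maximized over `a` in the Bellman equation for a function `w` of the state. -/
def bellmanValue (M : ParamMDP S A Θ) (θ : Θ) (w : S → ℝ) (s : S) (a : A) : ℝ :=
  M.reward θ s a + ∑ s', M.trans θ s a s' * w s'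

/-- `J θ` is the optimal average reward per round under `θ` (the same for all initial states),
and with `v · θ` as value function it satisfies the Bellman equation. -/
structure IsValueFunction (M : ParamMDP S A Θ) (J : Θ → ℝ) (v : S → Θ → ℝ) : Prop where
  optimal : ∀ θ s, J θ = M.optAverageReward θ s
  bellman : ∀ θ s, J θ + v s θ = ⨆ a : A, M.bellmanValue θ (fun s' => v s' θ) s a

/-- `πopt s θ` maximizes the right-hand side of the Bellman equation, for all `s` and `θ`. -/
def IsOptimalPolicy (M : ParamMDP S A Θ) (v : S → Θ → ℝ) (πopt : S → Θ → A) : Prop :=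
  ∀ θ s, ∀ a : A, M.bellmanValue θ (fun s' => v s' θ) s a ≤
    M.bellmanValue θ (fun s' => v s' θ) s (πopt s θ)

end ParamMDP

namespace BALSA

/-! Rounds are numbered `1, 2, 3, …`; the values of the processes at index `0` play no role. -/

section Stages

variable {X : Type*}

open Classical in
/-- Number of visits of the path `x` to the (state-action) pair `p` before round `t`. -/
def visits (x : ℕ → X) (t : ℕ) (p : X) : ℕ :=
  ((Finset.Ico 1 t).filter fun τ => x τ = p).card

/-- Start of the stage that follows a stage started in round `t`, when the stage before that one
had length `L`: the first round `u > t` with `u > t + L`, or with more than twice as many visits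
to some pair as before round `t`. -/
def nextStart (x : ℕ → X) (t L : ℕ) : ℕ :=
  sInf {u : ℕ | t < u ∧ (t + L < u ∨ ∃ p : X, 2 * visits x t p < visits x u p)}

/-- Start time of stage `k` along the path `x`. Stages are numbered from `1`; the value `0` at
`k = 0` encodes the convention that the stage before the first one has length `1`. -/
def stageStart (x : ℕ → X) : ℕ → ℕ
  | 0 => 0
  | 1 => 1
  | k + 2 => nextStart x (stageStart x (k + 1)) (stageStart x (k + 1) - stageStart x k)

/-- A new stage starts in round `t`. -/
def IsStageStart (x : ℕ → X) (t : ℕ) : Prop :=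
  ∃ k : ℕ, 1 ≤ k ∧ stageStart x k = t

end Stages

section Runs

variable {S A Θ Ω : Type*} [Fintype S] [MeasurableSpace Θ]
  [MeasurableSpace S] [MeasurableSpace A]

/-- The σ-algebra of the observed history before the action of round `t`: the states of rounds
`1, …, t` and the actions and rewards of rounds `1, …, t - 1`. -/
abbrev observed (M : ParamMDP S A Θ) (θ : Ω → Θ) (s : ℕ → Ω → S) (a : ℕ → Ω → A) (t : ℕ) :
    MeasurableSpace Ω :=
  (⨆ τ ∈ Finset.Icc 1 t, MeasurableSpace.comap (s τ) inferInstance) ⊔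
  (⨆ τ ∈ Finset.Ico 1 t, MeasurableSpace.comap (a τ) inferInstance) ⊔
  (⨆ τ ∈ Finset.Ico 1 t,
    MeasurableSpace.comap (fun ω => M.reward (θ ω) (s τ ω) (a τ ω)) (borel ℝ))

/-- The σ-algebra of everything that is determined just before a parameter may be drawn in round
`t`: the true parameter, the observed history, and the parameters used in earlier rounds. -/
abbrev beforeSampling (M : ParamMDP S A Θ) (θ : Ω → Θ) (s : ℕ → Ω → S) (a : ℕ → Ω → A)
    (ϑ : ℕ → Ω → Θ) (t : ℕ) : MeasurableSpace Ω :=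
  MeasurableSpace.comap θ inferInstance ⊔ observed M θ s a t ⊔
  (⨆ τ ∈ Finset.Ico 1 t, MeasurableSpace.comap (ϑ τ) inferInstance)

/-- The σ-algebra of everything that is determined just before the transition at the end of
round `t`. -/
abbrev beforeTransition (M : ParamMDP S A Θ) (θ : Ω → Θ) (s : ℕ → Ω → S) (a : ℕ → Ω → A)
    (ϑ : ℕ → Ω → Θ) (t : ℕ) : MeasurableSpace Ω :=
  beforeSampling M θ s a ϑ t ⊔ MeasurableSpace.comap (ϑ t) inferInstance ⊔
  MeasurableSpace.comap (a t) inferInstance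

variable [MeasurableSpace Ω]

/-- `θ`, `s`, `a`, `ϑ` are the true parameter, the states, the actions and the parameters in use
(`ϑ t` in round `t`) when BALSA with prior `μ₁` and optimal policies `πopt` runs on `M`. -/
structure IsRun (M : ParamMDP S A Θ) (μ₁ : Measure Θ) (πopt : S → Θ → A) (P : Measure Ω)
    (θ : Ω → Θ) (s : ℕ → Ω → S) (a : ℕ → Ω → A) (ϑ : ℕ → Ω → Θ) : Prop where
  measurable_param : Measurable θ
  measurable_state : ∀ t, Measurable (s t)
  measurable_action : ∀ t, Measurable (a t)
  measurable_sample : ∀ t, Measurable (ϑ t)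
  /-- The true parameter is distributed according to the prior. -/
  prior : P.map θ = μ₁
  /-- When a stage starts in round `t`, the parameter `ϑ t` is drawn from the posterior
  distribution of the true parameter given the observed history, independently of everything
  else. -/
  sample_start : ∀ t, 1 ≤ t → ∀ B : Set Θ, MeasurableSet B →
    ∀ᵐ ω ∂P, IsStageStart (fun τ => (s τ ω, a τ ω)) t →
      (P⟦ϑ t ⁻¹' B | beforeSampling M θ s a ϑ t⟧) ω = (P⟦θ ⁻¹' B | observed M θ s a t⟧) ω
  /-- Within a stage the sampled parameter is kept. -/
  sample_keep : ∀ t, 1 ≤ t → ∀ ω, ¬ IsStageStart (fun τ => (s τ ω, a τ ω)) (t + 1) →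
    ϑ (t + 1) ω = ϑ t ω
  /-- Actions follow the optimal policy for the sampled parameter. -/
  action_eq : ∀ t, 1 ≤ t → ∀ ω, a t ω = πopt (s t ω) (ϑ t ω)
  /-- States move according to the transition probabilities of the true parameter. -/
  transition : ∀ t, 1 ≤ t → ∀ s' : S,
    P⟦s (t + 1) ⁻¹' {s'} | beforeTransition M θ s a ϑ t⟧ =ᵐ[P]
      fun ω => M.trans (θ ω) (s t ω) (a t ω) s'

/-- Bayesian regret up to time `T`; the expectation is over the prior, the state transitions and
the sampling of the algorithm. -/
def regret (M : ParamMDP S A Θ) (J : Θ → ℝ) (P : Measure Ω)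
    (θ : Ω → Θ) (s : ℕ → Ω → S) (a : ℕ → Ω → A) (T : ℕ) : ℝ :=
  ∫ ω, ((T : ℝ) * J (θ ω) - ∑ t ∈ Finset.Icc 1 T, M.reward (θ ω) (s t ω) (a t ω)) ∂P

end Runs

/-- The bound on the regret, for `S` states, `A` actions and the bound `H` on the values. -/
def regretBound (S A : ℕ) (H : ℝ) (T : ℕ) : ℝ :=
  (H + 1) * √(2 * S * A * T * Real.log T) + 49 * H * S * √(A * T * Real.log (A * T))

end BALSA

end

/-! At the start of a stage the sampled parameter `ϑ` and the true parameter `θ` have the same joint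
law with the observed history (`IsRun.map_sample_eq`). Hence a function of history and parameter has
the same expectation at both, and an event that is unlikely for the truth is equally unlikely for
the sample.

The action played attains the maximum in the Bellman equation of the sampled model. Substituting
that equation splits the regret of a round into five terms: `J θ - J ϑ`, the reward error, the
transition error `∑ (P_ϑ - P_θ) v_ϑ`, a martingale difference of mean zero, and the increment of
`v_ϑ` along the states (`sum_regret_le`).

The increments telescope within a stage and cost at most `H` per stage. Stages are few: each is one
round longer than its predecessor unless a visit count more than doubled or the horizon cut it off,
and there are at most `SA log₂ T` doublings. Cauchy–Schwarz then gives order `√(SAT log T)` stages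
(`sq_card_stages_le`).

The sum of `J θ - J ϑ` over a stage carries the length of the stage, which depends on the sample.
The greatest possible length, one more than the preceding length, is known when the stage starts;
with this weight the expectation vanishes (`IsRun.integral_maxLength_mul`). What remains is `J ϑ - J
θ` times the missing length. If the first pair of the stage was visited before, its reward is known
exactly and comparing Bellman equations gives `J ϑ - J θ ≤ 2H`. If it is new, only the bound `1` is
available, but the stage then lasts a single round. These losses and the reward errors, which occur
only at new pairs, add up to `2√(SAT)` with no factor `H` (`sum_sub_add_card_new_le`).

For the transition error, an exponential supermartingale bounds the deviation of empirical moves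
into every set of states (`IsRun.measure_implausible_le`). Two plausible parameters then differ by
order `√(L/N)` after `N` visits, and summing `1/√N` along the path gives `√(SAT)`
(`sum_inv_sqrt_visits_le`). The level `L = 6 S log(AT)` absorbs the union bound.

For the limits, the Bellman inequality at the true parameter bounds the regret below by `-H`
(`IsRun.neg_le_regret`). -/

namespace BALSA

section StageLengths

/-! ### Sequences that grow by at most one per step -/

variable {l : ℕ → ℝ} {K : ℕ}

lemma sum_gap (h0 : l 0 = 1) (K : ℕ) :
    ∑ k ∈ Finset.range K, (l k + 1 - l (k + 1)) = K + 1 - l K := by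
  induction K with
  | zero => simp [h0]
  | succ K ih => rw [Finset.sum_range_succ, ih]; push_cast; ring

/-- Induction with the potential `x (x + 1)`: for a gap `D = l k + 1 - l (k + 1)`, the step reduces
to `D ≤ D * l (k + 1)`. A large gap must be paid for by a long climb before it. -/
lemma sum_gap_sq_le (h0 : l 0 = 1) (h1 : ∀ k ≤ K, 1 ≤ l k)
    (hstep : ∀ k < K, l (k + 1) ≤ l k + 1) :
    ∑ k ∈ Finset.range K, (l k + 1 - l (k + 1)) * (l k + 1 - l (k + 1) + 1) + l K * (l K + 1)
      ≤ 2 * ∑ k ∈ Finset.range (K + 1), l k := by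
  induction K with
  | zero => simp [h0]; norm_num
  | succ K ih =>
    have ih := ih (fun k hk => h1 k (by omega)) (fun k hk => hstep k (by omega))
    rw [Finset.sum_range_succ, Finset.sum_range_succ _ (K + 1)]
    have h2 := hstep K (by omega)
    have h3 := h1 (K + 1) le_rfl
    nlinarith [mul_nonneg (sub_nonneg.2 h2) (sub_nonneg.2 h3)]

/-- Cauchy–Schwarz: `K + 1` is the sum of the nonzero gaps and `l K`, and the squares of these terms
are controlled by `sum_gap_sq_le`. -/
lemma card_stages_sq_le (h0 : l 0 = 1) (h1 : ∀ k ≤ K, 1 ≤ l k)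
    (hstep : ∀ k < K, l (k + 1) ≤ l k + 1) :
    (K + 1 : ℝ) ^ 2 ≤
      (((Finset.range K).filter fun k => l k + 1 - l (k + 1) ≠ 0).card + 1) *
        (2 * ∑ k ∈ Finset.range (K + 1), l k) := by
  set E := (Finset.range K).filter fun k => l k + 1 - l (k + 1) ≠ 0
  have hE : ∑ k ∈ E, (l k + 1 - l (k + 1)) = K + 1 - l K := by
    rw [← sum_gap h0 K, Finset.sum_filter_ne_zero]
  have hcs : (∑ k ∈ E, (l k + 1 - l (k + 1))) ^ 2 ≤ E.card * ∑ k ∈ E, (l k + 1 - l (k + 1)) ^ 2 :=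
    sq_sum_le_card_mul_sum_sq
  have hw : ∑ k ∈ E, (l k + 1 - l (k + 1)) ^ 2 + l K ^ 2
      ≤ 2 * ∑ k ∈ Finset.range (K + 1), l k := by
    refine le_trans ?_ (sum_gap_sq_le h0 h1 hstep)
    gcongr ?_ + ?_
    · calc _ ≤ ∑ k ∈ Finset.range K, (l k + 1 - l (k + 1)) ^ 2 :=
            Finset.sum_le_sum_of_subset_of_nonneg (Finset.filter_subset _ _)
              fun _ _ _ => sq_nonneg _
        _ ≤ _ := Finset.sum_le_sum fun k hk => by
            have := hstep k (Finset.mem_range.1 hk)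
            nlinarith
    · nlinarith [h1 K le_rfl]
  rw [hE] at hcs
  set w := ∑ k ∈ E, (l k + 1 - l (k + 1)) ^ 2
  set u : ℝ := K + 1 - l K with hu
  have hw0 : 0 ≤ w := Finset.sum_nonneg fun _ _ => sq_nonneg _
  have he0 : (0 : ℝ) ≤ E.card := by positivity
  -- The cross term of `(u + l K) ^ 2`, from `u ^ 2 ≤ E.card * w` and the inequality of arithmetic
  -- and geometric means.
  have hcross : 2 * u * l K ≤ w + E.card * l K ^ 2 := by
    refine le_of_sq_le_sq ?_ (by positivity)
    nlinarith [sq_nonneg (w - E.card * l K ^ 2), mul_le_mul_of_nonneg_right hcs (sq_nonneg (l K))]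
  rw [show (K + 1 : ℝ) = u + l K by rw [hu]; ring]
  calc (u + l K) ^ 2 ≤ (E.card + 1) * (w + l K ^ 2) := by nlinarith
    _ ≤ _ := by gcongr

/-- At a reset the gap equals `l k`, so `sum_gap_sq_le` bounds `∑ l k (l k + 1)`; the parameter `c`
of the arithmetic-geometric mean inequality is left free, to be optimized later. -/
lemma sum_reset_add_le (h0 : l 0 = 1) (h1 : ∀ k ≤ K, 1 ≤ l k)
    (hstep : ∀ k < K, l (k + 1) ≤ l k + 1) {E : Finset ℕ} (hE : E ⊆ Finset.range K)
    (hreset : ∀ k ∈ E, l (k + 1) = 1) {N : ℝ} (hN : E.card ≤ N) {c : ℝ} (hc : 1 ≤ c) :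
    ∑ k ∈ E, l k + N ≤ N * c + (∑ k ∈ Finset.range (K + 1), l k - 1) / c := by
  have hpot : ∑ k ∈ E, l k * (l k + 1) ≤ 2 * (∑ k ∈ Finset.range (K + 1), l k - 1) := by
    have h2 := sum_gap_sq_le h0 h1 hstep
    have h3 : ∑ k ∈ E, l k * (l k + 1) ≤
        ∑ k ∈ Finset.range K, (l k + 1 - l (k + 1)) * (l k + 1 - l (k + 1) + 1) := by
      calc _ = ∑ k ∈ E, (l k + 1 - l (k + 1)) * (l k + 1 - l (k + 1) + 1) :=
            Finset.sum_congr rfl fun k hk => by rw [hreset k hk]; ring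
        _ ≤ _ := Finset.sum_le_sum_of_subset_of_nonneg hE fun k hk _ => by
            have := hstep k (Finset.mem_range.1 hk)
            have h : 0 ≤ l k + 1 - l (k + 1) := by linarith
            positivity
    nlinarith [h1 K le_rfl]
  have hterm : ∀ k ∈ E, l k + 1 ≤ c + l k * (l k + 1) / (2 * c) := by
    intro k hk
    have hk1 := h1 k (Finset.mem_range.1 (hE hk)).le
    rw [← sub_le_iff_le_add', le_div_iff₀ (by positivity)]
    nlinarith [sq_nonneg (l k + 1 - 2 * c)]
  have hsum := Finset.sum_le_sum hterm
  rw [Finset.sum_add_distrib, Finset.sum_add_distrib, ← Finset.sum_div] at hsum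
  simp only [Finset.sum_const, nsmul_eq_mul, mul_one] at hsum
  have hdiv : (∑ k ∈ E, l k * (l k + 1)) / (2 * c)
      ≤ (∑ k ∈ Finset.range (K + 1), l k - 1) / c := by
    rw [div_le_div_iff₀ (by positivity) (by positivity)]
    nlinarith
  nlinarith [mul_nonneg (sub_nonneg.2 hN) (sub_nonneg.2 hc)]

end StageLengths

/-! ### Visit counts along a path -/

section Visits

variable {X : Type*} {x y : ℕ → X} {t u L T : ℕ}

open Classical in
lemma visits_succ (x : ℕ → X) (ht : 1 ≤ t) (p : X) :
    visits x (t + 1) p = visits x t p + if x t = p then 1 else 0 := by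
  unfold visits
  rw [← Finset.insert_Ico_right_eq_Ico_add_one ht, Finset.filter_insert]
  split_ifs <;> simp

lemma visits_one (x : ℕ → X) (p : X) : visits x 1 p = 0 := by simp [visits]

lemma visits_mono (x : ℕ → X) (p : X) (h : t ≤ u) : visits x t p ≤ visits x u p := by
  classical
  exact Finset.card_le_card (Finset.filter_subset_filter _ (Finset.Ico_subset_Ico_right h))

lemma visits_le (x : ℕ → X) (t : ℕ) (p : X) : visits x t p ≤ t - 1 := by
  classical
  simpa [visits] using Finset.card_filter_le (Finset.Ico 1 t) fun τ => x τ = p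

lemma visits_self_pos (x : ℕ → X) (ht : 1 ≤ t) (h : t < u) : 0 < visits x u (x t) := by
  classical
  exact Finset.card_pos.2 ⟨t, by simp [ht, h]⟩

lemma visits_congr (h : ∀ τ ∈ Finset.Ico 1 u, x τ = y τ) (ht : t ≤ u) (p : X) :
    visits x t p = visits y t p := by
  classical
  unfold visits
  congr 1
  refine Finset.filter_congr fun τ hτ => ?_
  rw [h τ (Finset.Ico_subset_Ico_right ht hτ)]

lemma sum_visits [Fintype X] (x : ℕ → X) (t : ℕ) : ∑ p, visits x t p = t - 1 := by
  classical
  have h := Finset.card_eq_sum_card_fiberwise (f := x) (s := Finset.Ico 1 t)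
    (t := Finset.univ) (by simp)
  rw [Nat.card_Ico] at h
  rw [h]
  refine Finset.sum_congr rfl fun p _ => ?_
  unfold visits
  congr!

lemma card_new_le [Fintype X] (x : ℕ → X) (T : ℕ) :
    ((Finset.Icc 1 T).filter fun t => visits x t (x t) = 0).card ≤ Fintype.card X := by
  rw [← Finset.card_univ]
  refine Finset.card_le_card_of_injOn x (by simp) ?_
  have key : ∀ a b : ℕ, 1 ≤ a → visits x b (x b) = 0 → x a = x b → ¬ a < b := by
    intro a b ha hb hab hlt
    have := visits_self_pos x ha hlt
    rw [hab] at this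
    omega
  intro a ha b hb hab
  simp only [Finset.coe_filter, Finset.mem_Icc, Set.mem_ofPred_eq] at ha hb
  have h1 := key a b ha.1.1 hb.2 hab
  have h2 := key b a hb.1.1 ha.2 hab.symm
  omega

/-- For each pair the sum is of the form `∑ 1/√m ≤ 2√(N - 1)`, where `m` runs through `1, …, N - 1`;
Cauchy–Schwarz over the pairs finishes. First visits contribute nothing, since `1 / √0 = 0`. -/
lemma sum_inv_sqrt_visits_le [Fintype X] (x : ℕ → X) (T : ℕ) :
    ∑ t ∈ Finset.Icc 1 T, 1 / √(visits x t (x t) : ℝ) ≤ 2 * √(Fintype.card X * T) := by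
  classical
  have hpot : ∑ t ∈ Finset.Icc 1 T, 1 / √(visits x t (x t) : ℝ)
      ≤ ∑ p, 2 * √((visits x (T + 1) p - 1 : ℕ) : ℝ) := by
    induction T with
    | zero => simp [visits_one]
    | succ T ih =>
      rw [← Finset.insert_Icc_right_eq_Icc_add_one (by omega), Finset.sum_insert (by simp)]
      have hsplit := fun z : ℕ => Finset.sum_erase_add Finset.univ
        (fun p => 2 * √((visits x z p - 1 : ℕ) : ℝ)) (Finset.mem_univ (x (T + 1)))
      rw [← hsplit] at ih ⊢
      have hrest : ∑ p ∈ Finset.univ.erase (x (T + 1)), 2 * √((visits x (T + 1 + 1) p - 1 : ℕ) : ℝ)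
          = ∑ p ∈ Finset.univ.erase (x (T + 1)), 2 * √((visits x (T + 1) p - 1 : ℕ) : ℝ) := by
        refine Finset.sum_congr rfl fun p hp => ?_
        rw [visits_succ x (by omega), if_neg (Finset.ne_of_mem_erase hp).symm, add_zero]
      rw [hrest, visits_succ x (show 1 ≤ T + 1 by omega), if_pos rfl]
      -- For `m = 0` every term vanishes, the subtraction being truncated; for `m ≥ 1` this is `(√m
      -- - √(m - 1)) ^ 2 ≥ 0`.
      have hlast : ∀ m : ℕ, 1 / √(m : ℝ) + 2 * √((m - 1 : ℕ) : ℝ) ≤ 2 * √((m + 1 - 1 : ℕ) : ℝ) := by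
        intro m
        rcases Nat.eq_zero_or_pos m with rfl | hm
        · simp
        · have hm' : (0 : ℝ) < m := by exact_mod_cast hm
          rw [Nat.cast_sub hm, Nat.add_sub_cancel]
          have h1 := Real.sq_sqrt hm'.le
          have h2 := Real.sq_sqrt (show (0 : ℝ) ≤ m - 1 by
            have : (1 : ℝ) ≤ m := by exact_mod_cast hm
            linarith)
          have h3 := Real.sqrt_pos.2 hm'
          push_cast
          rw [← le_sub_iff_add_le, div_le_iff₀ h3]
          nlinarith [sq_nonneg (√(m : ℝ) - √((m : ℝ) - 1))]
      linarith [hlast (visits x (T + 1) (x (T + 1)))]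
  refine hpot.trans ?_
  rw [← Finset.mul_sum]
  gcongr
  refine Real.le_sqrt_of_sq_le ?_
  refine sq_sum_le_card_mul_sum_sq.trans ?_
  rw [Finset.card_univ]
  gcongr
  calc ∑ p, √((visits x (T + 1) p - 1 : ℕ) : ℝ) ^ 2
      = ∑ p, ((visits x (T + 1) p - 1 : ℕ) : ℝ) :=
        Finset.sum_congr rfl fun p _ => Real.sq_sqrt (by positivity)
    _ ≤ ∑ p, (visits x (T + 1) p : ℝ) :=
        Finset.sum_le_sum fun p _ => by exact_mod_cast Nat.sub_le _ _
    _ = T := by exact_mod_cast sum_visits x (T + 1)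

end Visits

/-! ### Stage starts: dependence on the past and number of doublings -/

section Starts

variable {X : Type*} {x y : ℕ → X} {t u L T K k : ℕ}

lemma nextStart_spec (x : ℕ → X) (t L : ℕ) :
    t < nextStart x t L ∧ (t + L < nextStart x t L ∨
      ∃ p : X, 2 * visits x t p < visits x (nextStart x t L) p) :=
  Nat.sInf_mem (s := {u : ℕ | t < u ∧ (t + L < u ∨ ∃ p : X, 2 * visits x t p < visits x u p)})
    ⟨t + L + 1, by simp⟩

lemma nextStart_le (x : ℕ → X) (t L : ℕ) : nextStart x t L ≤ t + L + 1 :=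
  Nat.sInf_le (by simp)

lemma nextStart_le_of_visits {p : X} (htu : t < u) (h : 2 * visits x t p < visits x u p) :
    nextStart x t L ≤ u :=
  Nat.sInf_le ⟨htu, Or.inr ⟨p, h⟩⟩

/-- The stopping rule never looks ahead: the round found for one path also satisfies the criterion
for the other. This makes stage starts measurable with respect to the history. -/
lemma nextStart_congr (h : ∀ τ ∈ Finset.Ico 1 u, x τ = y τ) (hle : nextStart x t L ≤ u) :
    nextStart y t L = nextStart x t L := by
  have key : ∀ {x y : ℕ → X}, (∀ τ ∈ Finset.Ico 1 u, x τ = y τ) → nextStart x t L ≤ u →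
      nextStart y t L ≤ nextStart x t L := by
    intro x y h hle
    obtain ⟨h1, h2⟩ := nextStart_spec x t L
    refine Nat.sInf_le ⟨h1, h2.imp_right fun ⟨p, hp⟩ => ⟨p, ?_⟩⟩
    rwa [← visits_congr h hle, ← visits_congr h (h1.le.trans hle)]
  exact (key h hle).antisymm (key (fun τ hτ => (h τ hτ).symm) ((key h hle).trans hle))

lemma stageStart_lt_succ (x : ℕ → X) (k : ℕ) : stageStart x k < stageStart x (k + 1) := by
  cases k with
  | zero => simp [stageStart]
  | succ k => exact (nextStart_spec x _ _).1

lemma stageStart_strictMono (x : ℕ → X) : StrictMono (stageStart x) :=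
  strictMono_nat_of_lt_succ (stageStart_lt_succ x)

lemma stageStart_add_le (x : ℕ → X) (k : ℕ) :
    stageStart x (k + 2) + stageStart x k ≤ 2 * stageStart x (k + 1) + 1 := by
  have h1 := nextStart_le x (stageStart x (k + 1)) (stageStart x (k + 1) - stageStart x k)
  have h2 := stageStart_lt_succ x k
  change nextStart x _ _ + _ ≤ _
  omega

lemma le_stageStart_of_visits {p : X} (hk : stageStart x (k + 1) < u)
    (h : 2 * visits x (stageStart x (k + 1)) p < visits x u p) : stageStart x (k + 2) ≤ u :=
  nextStart_le_of_visits hk h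

lemma visits_le_two_mul (h1 : stageStart x (k + 1) ≤ t) (h2 : t < stageStart x (k + 2)) (p : X) :
    visits x t p ≤ 2 * visits x (stageStart x (k + 1)) p := by
  rcases h1.eq_or_lt with h | h
  · rw [← h]; omega
  · by_contra! hlt
    have := le_stageStart_of_visits h hlt
    omega

lemma stageStart_congr (h : ∀ τ ∈ Finset.Ico 1 u, x τ = y τ) (hle : stageStart x k ≤ u) :
    stageStart y k = stageStart x k := by
  induction k using Nat.strong_induction_on with
  | _ k ih =>
    match k, ih with
    | 0, _ => rfl
    | 1, _ => rfl
    | k + 2, ih =>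
      have hm := (stageStart_strictMono x).monotone
      have e1 := ih (k + 1) (by omega) ((hm (by omega)).trans hle)
      have e0 := ih k (by omega) ((hm (by omega)).trans hle)
      change nextStart y _ _ = nextStart x _ _
      rw [e1, e0]
      exact nextStart_congr h hle

lemma stageStart_eq_iff_congr (h : ∀ τ ∈ Finset.Ico 1 u, x τ = y τ) (ht : t ≤ u) :
    stageStart x k = t ↔ stageStart y k = t := by
  constructor
  · rintro rfl
    exact stageStart_congr h ht
  · rintro rfl
    exact stageStart_congr (fun τ hτ => (h τ hτ).symm) ht

lemma isStageStart_congr (h : ∀ τ ∈ Finset.Ico 1 t, x τ = y τ) :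
    IsStageStart x t ↔ IsStageStart y t := by
  simp only [IsStageStart, stageStart_eq_iff_congr h le_rfl]

lemma isStageStart_stageStart (x : ℕ → X) (k : ℕ) : IsStageStart x (stageStart x (k + 1)) :=
  ⟨k + 1, by omega, rfl⟩

lemma exists_last_stage (x : ℕ → X) (hT : 1 ≤ T) :
    ∃ K, 1 ≤ K ∧ K ≤ T ∧ stageStart x K ≤ T ∧ T < stageStart x (K + 1) := by
  have hid := (stageStart_strictMono x).id_le
  have h1 : stageStart x 1 ≤ T := hT
  refine ⟨Nat.findGreatest (fun k => stageStart x k ≤ T) T, Nat.le_findGreatest hT h1,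
    Nat.findGreatest_le T, Nat.findGreatest_spec (P := fun k => stageStart x k ≤ T) hT h1, ?_⟩
  by_contra! h
  have := Nat.le_findGreatest (P := fun k => stageStart x k ≤ T) ((hid _).trans h) h
  simp at this

lemma eq_of_keep_of_mem_stage {β : Type*} {j : ℕ → β}
    (hj : ∀ t, 1 ≤ t → ¬ IsStageStart x (t + 1) → j (t + 1) = j t)
    (h1 : stageStart x (k + 1) ≤ t) (h2 : t < stageStart x (k + 2)) :
    j t = j (stageStart x (k + 1)) := by
  have h0 : 1 ≤ stageStart x (k + 1) := ((stageStart_strictMono x).id_le (k + 1)).trans' (by simp)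
  have key : ∀ d, stageStart x (k + 1) + d < stageStart x (k + 2) →
      j (stageStart x (k + 1) + d) = j (stageStart x (k + 1)) := by
    intro d
    induction d with
    | zero => simp
    | succ d ih =>
      intro hd
      rw [← ih (by omega), ← add_assoc]
      refine hj _ (by omega) ?_
      rintro ⟨i, -, hi⟩
      have hm := stageStart_strictMono x
      have h2 : k + 1 < i := hm.lt_iff_lt.1 (by omega)
      have h3 : i < k + 2 := hm.lt_iff_lt.1 (by omega)
      omega
  have := key (t - stageStart x (k + 1)) (by omega)
  rwa [Nat.add_sub_cancel' h1] at this

/-- The start `u` of the stage that contains round `t`. -/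
lemma exists_current_start (x : ℕ → X) (ht : 1 ≤ t) :
    ∃ u, 1 ≤ u ∧ u ≤ t ∧ IsStageStart x u ∧ (∀ p, visits x t p ≤ 2 * visits x u p) ∧
      ∀ {β : Type*} (j : ℕ → β), (∀ t, 1 ≤ t → ¬ IsStageStart x (t + 1) → j (t + 1) = j t) →
        j t = j u := by
  obtain ⟨K, hK1, -, hKt, htK⟩ := exists_last_stage x ht
  obtain ⟨k, rfl⟩ : ∃ k, K = k + 1 := ⟨K - 1, by omega⟩
  have h1 : 1 ≤ stageStart x (k + 1) := ((stageStart_strictMono x).id_le (k + 1)).trans' (by simp)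
  exact ⟨_, h1, hKt, isStageStart_stageStart x k, visits_le_two_mul hKt htK,
    fun j hj => eq_of_keep_of_mem_stage hj hKt htK⟩

lemma card_isStageStart_succ_le (hT : T < stageStart x (K + 1)) :
    (({t ∈ Finset.Icc 1 T | IsStageStart x (t + 1)} : Set ℕ)).ncard ≤ K := by
  have hsub : ({t ∈ Finset.Icc 1 T | IsStageStart x (t + 1)} : Set ℕ) ⊆
      ((Finset.range K).image fun k => stageStart x (k + 2) - 1 : Finset ℕ) := by
    rintro t ⟨ht, i, -, hi⟩
    have ht := Finset.mem_Icc.1 ht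
    have hm := stageStart_strictMono x
    have h1 : 1 < i := hm.lt_iff_lt.1 (by rw [hi]; simp [stageStart]; omega)
    have h2 : i ≤ K + 1 := hm.le_iff_le.1 (by omega)
    simp only [Finset.coe_image, Set.mem_image, Finset.coe_range, Set.mem_Iio]
    refine ⟨i - 2, by omega, ?_⟩
    rw [show i - 2 + 2 = i by omega, hi]
    rfl
  calc _ ≤ _ := Set.ncard_le_ncard hsub (Finset.finite_toSet _)
    _ ≤ _ := by rw [Set.ncard_coe_finset]; exact Finset.card_image_le.trans (by simp)

-- `2 * V < V'` gives `2 * (1 + V) ≤ 1 + V'`, so one plus the visit count of a fixed pair at least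
-- doubles each time. It never exceeds `T`, which allows `Nat.log 2 T` doublings per pair.
open Classical in
lemma card_doubling_le [Fintype X] (x : ℕ → X) (K : ℕ) (hT : stageStart x (K + 1) ≤ T) :
    ((Finset.range K).filter fun k =>
      ∃ p, 2 * visits x (stageStart x (k + 1)) p < visits x (stageStart x (k + 2)) p).card
      ≤ Fintype.card X * Nat.log 2 T := by
  have hp : ∀ (p : X) (K : ℕ), 2 ^ ((Finset.range K).filter fun k =>
      2 * visits x (stageStart x (k + 1)) p < visits x (stageStart x (k + 2)) p).card
      ≤ 1 + visits x (stageStart x (K + 1)) p := by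
    intro p K
    induction K with
    | zero => simp
    | succ K ih =>
      rw [Finset.range_add_one, Finset.filter_insert]
      split_ifs with h
      · rw [Finset.card_insert_of_notMem (by simp), pow_succ, show K + 1 + 1 = K + 2 from rfl]
        omega
      · exact ih.trans (by
          have := visits_mono x p (stageStart_lt_succ x (K + 1)).le
          omega)
  have hT1 : 1 ≤ stageStart x (K + 1) := ((stageStart_strictMono x).id_le (K + 1)).trans' (by simp)
  calc _ ≤ (Finset.univ.biUnion fun p : X => (Finset.range K).filter fun k =>
        2 * visits x (stageStart x (k + 1)) p < visits x (stageStart x (k + 2)) p).card := by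
        refine Finset.card_le_card fun k hk => ?_
        simpa using hk
    _ ≤ ∑ p : X, Nat.log 2 T := by
        refine Finset.card_biUnion_le.trans (Finset.sum_le_sum fun p _ => ?_)
        refine Nat.le_log_of_pow_le (by norm_num) ((hp p K).trans ?_)
        have := visits_le x (stageStart x (K + 1)) p
        omega
    _ = _ := by simp

end Starts

/-! ### Lengths of stages and the number of stages -/

section Lengths

variable {X : Type*} {x : ℕ → X} {T K k : ℕ}

/-- Length of stage `k`, cut off after round `T`. -/
noncomputable def cutLength (x : ℕ → X) (T k : ℕ) : ℝ :=
  (min (stageStart x (k + 1)) (T + 1) : ℕ) - (min (stageStart x k) (T + 1) : ℕ)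

lemma cutLength_zero (x : ℕ → X) (T : ℕ) : cutLength x T 0 = 1 := by
  simp [cutLength, stageStart]

lemma stageStart_le_of_le (hK : stageStart x K ≤ T) (hk : k ≤ K) : stageStart x k ≤ T :=
  ((stageStart_strictMono x).monotone hk).trans hK

lemma one_le_cutLength (hK : stageStart x K ≤ T) (hk : k ≤ K) : 1 ≤ cutLength x T k := by
  have h1 := stageStart_le_of_le hK hk
  have h2 := stageStart_lt_succ x k
  have h3 : min (stageStart x k) (T + 1) + 1 ≤ min (stageStart x (k + 1)) (T + 1) := by omega
  have h4 : ((min (stageStart x k) (T + 1) : ℕ) : ℝ) + 1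
      ≤ (min (stageStart x (k + 1)) (T + 1) : ℕ) := by
    exact_mod_cast h3
  unfold cutLength
  linarith

lemma cutLength_succ_le (hK : stageStart x K ≤ T) (hk : k < K) :
    cutLength x T (k + 1) ≤ cutLength x T k + 1 := by
  have h1 := stageStart_le_of_le hK (show k + 1 ≤ K from hk)
  have h2 := stageStart_lt_succ x k
  have h3 := stageStart_add_le x k
  have h4 : min (stageStart x (k + 2)) (T + 1) + min (stageStart x k) (T + 1)
      ≤ 2 * min (stageStart x (k + 1)) (T + 1) + 1 := by omega
  have h5 : ((min (stageStart x (k + 2)) (T + 1) : ℕ) : ℝ) + (min (stageStart x k) (T + 1) : ℕ)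
      ≤ 2 * (min (stageStart x (k + 1)) (T + 1) : ℕ) + 1 := by exact_mod_cast h4
  unfold cutLength
  rw [show k + 1 + 1 = k + 2 from rfl]
  linarith

lemma cutLength_eq (hK : stageStart x K ≤ T) (hk : k < K) :
    cutLength x T k = stageStart x (k + 1) - stageStart x k := by
  have h1 := stageStart_le_of_le hK (show k + 1 ≤ K from hk)
  have h2 := stageStart_lt_succ x k
  rw [cutLength, min_eq_left (by omega), min_eq_left (by omega)]

lemma sum_cutLength (hT : T < stageStart x (K + 1)) :
    ∑ k ∈ Finset.range (K + 1), cutLength x T k = T + 1 := by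
  unfold cutLength
  rw [Finset.sum_range_sub fun k => ((min (stageStart x k) (T + 1) : ℕ) : ℝ),
    min_eq_right (by omega)]
  simp [stageStart]

/-- One visit exceeds twice zero visits, so a stage that opens with a new pair ends after that
round. -/
lemma cutLength_of_new (hK : stageStart x K ≤ T) (hk : k < K)
    (hnew : visits x (stageStart x (k + 1)) (x (stageStart x (k + 1))) = 0) :
    cutLength x T (k + 1) = 1 := by
  have h1 := stageStart_le_of_le hK (show k + 1 ≤ K from hk)
  have h2 := stageStart_lt_succ x (k + 1)
  have h3 : stageStart x (k + 2) ≤ stageStart x (k + 1) + 1 := by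
    refine le_stageStart_of_visits (p := x (stageStart x (k + 1))) (by omega) ?_
    rw [hnew]
    have := stageStart_lt_succ x k
    exact visits_self_pos x (by omega) (by omega)
  rw [show k + 1 + 1 = k + 2 from rfl] at h2
  have h4 : min (stageStart x (k + 2)) (T + 1) = min (stageStart x (k + 1)) (T + 1) + 1 := by
    omega
  rw [cutLength, show k + 1 + 1 = k + 2 from rfl, h4]
  push_cast
  ring

/-- Bound on the number `K` of stages that start in the rounds `1, …, T`. -/
lemma sq_card_stages_le [Fintype X] (hK1 : 1 ≤ K) (hK : stageStart x K ≤ T)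
    (hT : T < stageStart x (K + 1)) :
    (K : ℝ) ^ 2 ≤ (Fintype.card X * Nat.log 2 T + 2 : ℕ) * (2 * (T + 1)) := by
  classical
  have h := card_stages_sq_le (K := K) (cutLength_zero x T) (fun k hk => one_le_cutLength hK hk)
    (fun k hk => cutLength_succ_le hK hk)
  rw [sum_cutLength hT] at h
  obtain ⟨m, rfl⟩ : ∃ m, K = m + 1 := ⟨K - 1, by omega⟩
  -- A nonzero gap at `k` means that stage `k + 1` stopped before its greatest length: because of a
  -- doubling, or, for the last stage `m + 1`, possibly because of the cut at `T`. This exception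
  -- and the `+ 1` of `card_stages_sq_le` make up the `+ 2`.
  have hcard : ((Finset.range (m + 1)).filter fun k =>
      cutLength x T k + 1 - cutLength x T (k + 1) ≠ 0).card ≤ Fintype.card X * Nat.log 2 T + 1 := by
    calc _ ≤ (insert m ((Finset.range m).filter fun k =>
          ∃ p, 2 * visits x (stageStart x (k + 1)) p < visits x (stageStart x (k + 2)) p)).card := by
          refine Finset.card_le_card fun k hk => ?_
          obtain ⟨hkm, hne⟩ := Finset.mem_filter.1 hk
          rw [Finset.mem_range] at hkm
          rw [Finset.mem_insert, Finset.mem_filter, Finset.mem_range]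
          rcases Nat.lt_succ_iff_lt_or_eq.1 hkm with hlt | rfl
          · refine Or.inr ⟨hlt, ?_⟩
            refine (nextStart_spec x (stageStart x (k + 1))
              (stageStart x (k + 1) - stageStart x k)).2.resolve_left fun hlong => hne ?_
            change _ < stageStart x (k + 2) at hlong
            have h2 := stageStart_add_le x k
            have h3 := stageStart_lt_succ x k
            have h4 : stageStart x (k + 2) + stageStart x k = 2 * stageStart x (k + 1) + 1 := by
              omega
            have h5 : (stageStart x (k + 2) : ℝ) + stageStart x k = 2 * stageStart x (k + 1) + 1 := by
              exact_mod_cast h4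
            rw [cutLength_eq hK (by omega), cutLength_eq hK (by omega)]
            rw [show k + 1 + 1 = k + 2 from rfl]
            linarith
          · exact Or.inl rfl
      _ ≤ _ := (Finset.card_insert_le _ _).trans (Nat.succ_le_succ (card_doubling_le x m hK))
  refine le_trans ?_ (h.trans ?_)
  · gcongr; linarith
  · gcongr
    exact_mod_cast Nat.succ_le_succ hcard

lemma sum_stages (f : ℕ → ℝ) (hT : T < stageStart x (K + 1)) :
    ∑ t ∈ Finset.Icc 1 T, f t = ∑ k ∈ Finset.range K,
      ∑ t ∈ Finset.Ico (min (stageStart x (k + 1)) (T + 1)) (min (stageStart x (k + 2)) (T + 1)),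
        f t := by
  have hmono : Monotone fun k => min (stageStart x (k + 1)) (T + 1) := fun a b hab =>
    min_le_min_right _ ((stageStart_strictMono x).monotone (by omega))
  have key : ∀ K, ∑ k ∈ Finset.range K,
      ∑ t ∈ Finset.Ico (min (stageStart x (k + 1)) (T + 1)) (min (stageStart x (k + 2)) (T + 1)),
        f t = ∑ t ∈ Finset.Ico 1 (min (stageStart x (K + 1)) (T + 1)), f t := by
    intro K
    induction K with
    | zero => simp [stageStart]
    | succ K ih =>
      rw [Finset.sum_range_succ, ih]
      refine Finset.sum_Ico_consecutive f ?_ (hmono (Nat.le_succ K))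
      simpa [stageStart] using hmono (Nat.zero_le K)
  rw [key, min_eq_right (by omega), Finset.Ico_add_one_right_eq_Icc]

/-- When a stage starts in round `u`, one more than the length of the preceding stage;
otherwise `0`. -/
noncomputable def maxLength (x : ℕ → X) (u : ℕ) : ℝ :=
  ∑ k ∈ Finset.range u, if stageStart x (k + 1) = u then (u : ℝ) - stageStart x k + 1 else 0

lemma maxLength_eq_zero {u : ℕ} (h : ¬ IsStageStart x u) : maxLength x u = 0 :=
  Finset.sum_eq_zero fun k _ => if_neg fun hk => h ⟨k + 1, by omega, hk⟩

lemma maxLength_congr {y : ℕ → X} {u : ℕ} (h : ∀ τ ∈ Finset.Ico 1 u, x τ = y τ) :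
    maxLength x u = maxLength y u := by
  refine Finset.sum_congr rfl fun k _ => ?_
  by_cases hk : stageStart y (k + 1) = u
  · have := stageStart_lt_succ y k
    rw [if_pos hk, if_pos ((stageStart_eq_iff_congr h le_rfl).2 hk),
      stageStart_congr (x := y) (k := k) (fun τ hτ => (h τ hτ).symm) (by omega)]
  · rw [if_neg hk, if_neg fun h' => hk ((stageStart_eq_iff_congr h le_rfl).1 h')]

lemma sum_maxLength_mul (f : ℕ → ℝ) (hK : stageStart x K ≤ T) (hT : T < stageStart x (K + 1)) :
    ∑ u ∈ Finset.Icc 1 T, maxLength x u * f u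
      = ∑ k ∈ Finset.range K, (cutLength x T k + 1) * f (stageStart x (k + 1)) := by
  have hid := (stageStart_strictMono x).id_le
  have hKT : K ≤ T := (hid K).trans hK
  have h1 : ∀ u ∈ Finset.Icc 1 T, maxLength x u * f u = ∑ k ∈ Finset.range T,
      if stageStart x (k + 1) = u then ((u : ℝ) - stageStart x k + 1) * f u else 0 := by
    intro u hu
    have hu := (Finset.mem_Icc.1 hu).2
    rw [maxLength, Finset.sum_mul]
    simp only [ite_mul, zero_mul]
    refine Finset.sum_subset (by simpa using hu) fun k _ hk => if_neg fun h => hk ?_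
    have := hid (k + 1)
    simp only [id] at this
    rw [Finset.mem_range]
    omega
  rw [Finset.sum_congr rfl h1, Finset.sum_comm]
  simp only [Finset.sum_ite_eq]
  have h2 : Finset.range K ⊆ Finset.range T := by simpa using hKT
  rw [← Finset.sum_subset h2]
  · refine Finset.sum_congr rfl fun k hk => ?_
    have hk := Finset.mem_range.1 hk
    have h3 := stageStart_le_of_le hK (show k + 1 ≤ K from hk)
    have h4 := stageStart_lt_succ x k
    rw [if_pos (Finset.mem_Icc.2 ⟨by omega, h3⟩), cutLength_eq hK hk]
  · intro k _ hk
    refine if_neg fun h => hk ?_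
    rw [Finset.mem_range, ← Nat.succ_lt_succ_iff]
    exact (stageStart_strictMono x).lt_iff_lt.1 ((Finset.mem_Icc.1 h).2.trans_lt hT)

open Classical in
/-- Replacing the lengths of the stages by their greatest possible values. -/
lemma sum_sub_add_card_new_le [Fintype X] {j : ℕ → ℝ} {c b : ℝ} (hb : 0 ≤ b)
    (hn : Fintype.card X ≤ T) (hT1 : 1 ≤ T)
    (hj : ∀ t, 1 ≤ t → ¬ IsStageStart x (t + 1) → j (t + 1) = j t)
    (hj1 : ∀ t, 1 ≤ t → j t - c ≤ 1)
    (hjb : ∀ u, 1 ≤ u → u ≤ T → IsStageStart x u → visits x u (x u) ≠ 0 → j u - c ≤ b)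
    (hK : stageStart x K ≤ T) (hT : T < stageStart x (K + 1)) :
    ∑ t ∈ Finset.Icc 1 T, (c - j t)
        + ((Finset.Icc 1 T).filter fun t => visits x t (x t) = 0).card
      ≤ ∑ u ∈ Finset.Icc 1 T, maxLength x u * (c - j u) + b * K
        + 2 * √(Fintype.card X * T) := by
  have hstart : ∀ k, 1 ≤ stageStart x (k + 1) := fun k =>
    ((stageStart_strictMono x).id_le (k + 1)).trans' (by simp)
  set l := cutLength x T with hl
  have hl0 : l 0 = 1 := cutLength_zero x T
  have hl1 : ∀ k ≤ K, 1 ≤ l k := fun k hk => one_le_cutLength hK hk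
  have hstep : ∀ k < K, l (k + 1) ≤ l k + 1 := fun k hk => cutLength_succ_le hK hk
  have hsum : ∑ t ∈ Finset.Icc 1 T, (c - j t)
      = ∑ k ∈ Finset.range K, l (k + 1) * (c - j (stageStart x (k + 1))) := by
    rw [sum_stages _ hT]
    refine Finset.sum_congr rfl fun k hk => ?_
    have hk := Finset.mem_range.1 hk
    have h1 := stageStart_le_of_le hK (show k + 1 ≤ K from hk)
    have h2 := stageStart_lt_succ x (k + 1)
    rw [Finset.sum_congr rfl (g := fun _ => c - j (stageStart x (k + 1)))]
    · rw [Finset.sum_const, Nat.card_Ico, nsmul_eq_mul, hl, cutLength,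
        Nat.cast_sub (min_le_min_right _ h2.le)]
    · intro t ht
      rw [Finset.mem_Ico] at ht
      rw [eq_of_keep_of_mem_stage (k := k) hj (by omega) (by omega)]
  set E := (Finset.range K).filter fun k =>
    visits x (stageStart x (k + 1)) (x (stageStart x (k + 1))) = 0
  have hEcard : E.card ≤ ((Finset.Icc 1 T).filter fun t => visits x t (x t) = 0).card := by
    refine Finset.card_le_card_of_injOn (fun k => stageStart x (k + 1)) ?_ ?_
    · intro k hk
      obtain ⟨hk, hnew⟩ := Finset.mem_filter.1 hk
      refine Finset.mem_filter.2 ⟨Finset.mem_Icc.2 ⟨hstart k, ?_⟩, hnew⟩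
      exact stageStart_le_of_le hK (Finset.mem_range.1 hk)
    · intro a _ b _ hab
      have := (stageStart_strictMono x).injective hab
      omega
  have hn0 : 0 < Fintype.card X := Fintype.card_pos_iff.2 ⟨x 0⟩
  have hn0' : (0 : ℝ) < Fintype.card X := by exact_mod_cast hn0
  have hT0 : (0 : ℝ) < T := by exact_mod_cast hT1
  -- This choice balances `n * d` and `T / d`, both equal to `√(n * T)` for `n = Fintype.card X`; `n
  -- ≤ T` ensures `1 ≤ d`.
  set d : ℝ := √(T / Fintype.card X) with hd
  have hd1 : 1 ≤ d := by
    rw [hd, Real.one_le_sqrt, one_le_div hn0']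
    exact_mod_cast hn
  have hreset := sum_reset_add_le hl0 hl1 hstep (E := E) (Finset.filter_subset _ _)
    (fun k hk => cutLength_of_new hK (Finset.mem_range.1 (Finset.mem_filter.1 hk).1)
      (Finset.mem_filter.1 hk).2)
    (N := ((Finset.Icc 1 T).filter fun t => visits x t (x t) = 0).card)
    (by exact_mod_cast hEcard) hd1
  rw [hl, sum_cutLength hT, ← hl, add_sub_cancel_right] at hreset
  have hroot : (((Finset.Icc 1 T).filter fun t => visits x t (x t) = 0).card : ℝ) * d + T / d
      ≤ 2 * √(Fintype.card X * T) := by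
    have hN : (((Finset.Icc 1 T).filter fun t => visits x t (x t) = 0).card : ℝ)
        ≤ Fintype.card X := by exact_mod_cast card_new_le x T
    have h1 : (Fintype.card X : ℝ) * d = √(Fintype.card X * T) := by
      rw [hd, eq_comm, Real.sqrt_eq_iff_mul_self_eq (by positivity) (by positivity)]
      rw [mul_mul_mul_comm, Real.mul_self_sqrt (by positivity)]
      field_simp
    have h2 : T / d = √(Fintype.card X * T) := by
      rw [div_eq_iff (by positivity), hd, ← Real.sqrt_mul (by positivity), eq_comm,
        Real.sqrt_eq_iff_mul_self_eq (by positivity) (by positivity)]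
      field_simp
    nlinarith
  -- The cost of replacing lengths: a stage opening with a new pair has gap exactly `l k` and is
  -- charged with factor `1`; the others are charged with `b`, and all gaps together sum to at most
  -- `K`.
  have hgap : ∑ k ∈ Finset.range K, (l k + 1 - l (k + 1)) * (j (stageStart x (k + 1)) - c)
      ≤ ∑ k ∈ E, l k + b * K := by
    have h1 : ∀ k ∈ Finset.range K, (l k + 1 - l (k + 1)) * (j (stageStart x (k + 1)) - c)
        ≤ (if visits x (stageStart x (k + 1)) (x (stageStart x (k + 1))) = 0 then l k else 0)
          + b * (l k + 1 - l (k + 1)) := by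
      intro k hk
      have hk := Finset.mem_range.1 hk
      have hD : 0 ≤ l k + 1 - l (k + 1) := by linarith [hstep k hk]
      split_ifs with hnew
      · have h2 : l (k + 1) = 1 := cutLength_of_new hK hk hnew
        have h3 := hj1 _ (hstart k)
        nlinarith [hl1 k hk.le]
      · have h3 := hjb _ (hstart k) (stageStart_le_of_le hK hk) (isStageStart_stageStart x k) hnew
        nlinarith
    refine (Finset.sum_le_sum h1).trans ?_
    rw [Finset.sum_add_distrib, ← Finset.mul_sum, ← Finset.sum_filter, sum_gap hl0]
    gcongr
    linarith [hl1 K le_rfl]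
  rw [sum_maxLength_mul _ hK hT, hsum]
  have hsplit : ∑ k ∈ Finset.range K, l (k + 1) * (c - j (stageStart x (k + 1)))
      = ∑ k ∈ Finset.range K, (l k + 1) * (c - j (stageStart x (k + 1)))
        + ∑ k ∈ Finset.range K, (l k + 1 - l (k + 1)) * (j (stageStart x (k + 1)) - c) := by
    rw [← Finset.sum_add_distrib]
    exact Finset.sum_congr rfl fun k _ => by ring
  rw [hsplit]
  linarith

end Lengths

lemma measurable_apply_of_countable {Ω ι Θ β : Type*} {mΩ : MeasurableSpace Ω}
    [Countable ι] [MeasurableSpace ι] [MeasurableSingletonClass ι] [MeasurableSpace Θ]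
    [MeasurableSpace β] {f : ι → Θ → β} (hf : ∀ i, Measurable (f i)) {i : Ω → ι} {g : Ω → Θ}
    (hi : Measurable i) (hg : Measurable g) : Measurable fun ω => f (i ω) (g ω) :=
  (measurable_from_prod_countable_right (f := fun z : ι × Θ => f z.1 z.2) hf).comp (hi.prodMk hg)

/-! ### Measurability with respect to the observed history -/

section History

variable {S A Θ Ω : Type*} [Fintype S] [MeasurableSpace Θ] [MeasurableSpace S] [MeasurableSpace A]
  {M : ParamMDP S A Θ} {θ : Ω → Θ} {s : ℕ → Ω → S} {a : ℕ → Ω → A} {ϑ : ℕ → Ω → Θ} {t u τ : ℕ}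

lemma measurable_state_observed (h1 : 1 ≤ τ) (h2 : τ ≤ t) :
    Measurable[observed M θ s a t] (s τ) :=
  (comap_measurable (s τ)).mono ((le_iSup₂
    (f := fun τ (_ : τ ∈ Finset.Icc 1 t) => MeasurableSpace.comap (s τ) inferInstance) τ
    (Finset.mem_Icc.2 ⟨h1, h2⟩)).trans (le_sup_left.trans le_sup_left)) le_rfl

lemma measurable_action_observed (h1 : 1 ≤ τ) (h2 : τ < t) :
    Measurable[observed M θ s a t] (a τ) :=
  (comap_measurable (a τ)).mono ((le_iSup₂
    (f := fun τ (_ : τ ∈ Finset.Ico 1 t) => MeasurableSpace.comap (a τ) inferInstance) τ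
    (Finset.mem_Ico.2 ⟨h1, h2⟩)).trans (le_sup_right.trans le_sup_left)) le_rfl

lemma measurable_reward_observed (h1 : 1 ≤ τ) (h2 : τ < t) :
    Measurable[observed M θ s a t] fun ω => M.reward (θ ω) (s τ ω) (a τ ω) := by
  refine Measurable.mono (ma := MeasurableSpace.comap
    (fun ω => M.reward (θ ω) (s τ ω) (a τ ω)) (borel ℝ)) ?_
    ((le_iSup₂ (f := fun τ (_ : τ ∈ Finset.Ico 1 t) => MeasurableSpace.comap
      (fun ω => M.reward (θ ω) (s τ ω) (a τ ω)) (borel ℝ)) τ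
      (Finset.mem_Ico.2 ⟨h1, h2⟩)).trans le_sup_right) le_rfl
  rw [← BorelSpace.measurable_eq]
  exact comap_measurable _

lemma measurable_pair_observed (h1 : 1 ≤ τ) (h2 : τ < t) :
    Measurable[observed M θ s a t] fun ω => (s τ ω, a τ ω) :=
  (measurable_state_observed h1 h2.le).prodMk (measurable_action_observed h1 h2)

lemma observed_le_beforeTransition : observed M θ s a t ≤ beforeTransition M θ s a ϑ t :=
  ((le_sup_right.trans le_sup_left).trans le_sup_left).trans le_sup_left

lemma measurable_param_beforeTransition : Measurable[beforeTransition M θ s a ϑ t] θ :=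
  (comap_measurable θ).mono
    (((le_sup_left.trans le_sup_left).trans le_sup_left).trans le_sup_left) le_rfl

lemma measurable_sample_beforeTransition : Measurable[beforeTransition M θ s a ϑ t] (ϑ t) :=
  (comap_measurable (ϑ t)).mono (le_sup_right.trans le_sup_left) le_rfl

lemma measurable_pair_beforeTransition (ht : 1 ≤ t) :
    Measurable[beforeTransition M θ s a ϑ t] fun ω => (s t ω, a t ω) :=
  ((measurable_state_observed ht le_rfl).mono observed_le_beforeTransition le_rfl).prodMk
    ((comap_measurable (a t)).mono le_sup_right le_rfl)

/-- Functions of the pairs played before round `u` are determined by the history. -/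
lemma measurable_observed_of_congr [Countable A] [MeasurableSingletonClass S]
    [MeasurableSingletonClass A] {β : Type*} [MeasurableSpace β] {F : (ℕ → S × A) → β}
    (hF : ∀ x y : ℕ → S × A, (∀ τ ∈ Finset.Ico 1 u, x τ = y τ) → F x = F y) :
    Measurable[observed M θ s a u] fun ω => F fun τ => (s τ ω, a τ ω) := by
  classical
  rcases isEmpty_or_nonempty Ω with hΩ | ⟨⟨ω₀⟩⟩
  · exact @measurable_of_empty _ _ (observed M θ s a u) _ _ _
  let r : Ω → (Finset.Ico 1 u → S × A) := fun ω τ => (s τ ω, a τ ω)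
  -- The finite tuple of played pairs is continued by an arbitrary constant; `F` does not see the
  -- continuation, and every function on the finite discrete product is measurable.
  let G : (Finset.Ico 1 u → S × A) → β := fun z =>
    F fun τ => if h : τ ∈ Finset.Ico 1 u then z ⟨τ, h⟩ else (s 0 ω₀, a 0 ω₀)
  have hr : Measurable[observed M θ s a u] r := by
    refine @measurable_pi_lambda _ _ _ (observed M θ s a u) _ _ fun τ => ?_
    have hτ := Finset.mem_Ico.1 τ.2
    exact measurable_pair_observed hτ.1 hτ.2
  have hG : Measurable G := Measurable.of_discrete
  have heq : (fun ω => F fun τ => (s τ ω, a τ ω)) = G ∘ r := by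
    funext ω
    refine hF _ _ fun τ hτ => ?_
    simp only [r, dif_pos hτ]
  rw [heq]
  exact hG.comp hr

lemma measurableSet_isStageStart [Countable A] [MeasurableSingletonClass S]
    [MeasurableSingletonClass A] (u : ℕ) :
    MeasurableSet[observed M θ s a u] {ω | IsStageStart (fun τ => (s τ ω, a τ ω)) u} :=
  measurable_observed_of_congr (F := fun x => IsStageStart x u)
    (fun _ _ h => propext (isStageStart_congr h)) (measurableSet_setOfPred.2 measurable_id)

end History

/-! ### Posterior sampling and the transition law in expectation -/

namespace IsRun

variable {S A Θ Ω : Type*} [Fintype S] [Fintype A] [MeasurableSpace Θ]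
  [MeasurableSpace S] [MeasurableSingletonClass S] [MeasurableSpace A] [MeasurableSingletonClass A]
  [MeasurableSpace Ω] {M : ParamMDP S A Θ} {μ₁ : Measure Θ} {πopt : S → Θ → A} {P : Measure Ω}
  {θ : Ω → Θ} {s : ℕ → Ω → S} {a : ℕ → Ω → A} {ϑ : ℕ → Ω → Θ} {t u : ℕ}

lemma measurable_reward_comp (hrun : IsRun M μ₁ πopt P θ s a ϑ) {g : Ω → Θ} (hg : Measurable g)
    (t : ℕ) : Measurable fun ω => M.reward (g ω) (s t ω) (a t ω) :=
  measurable_apply_of_countable (f := fun (p : S × A) ϑ => M.reward ϑ p.1 p.2)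
    (fun p => M.measurable_reward p.1 p.2)
    ((hrun.measurable_state t).prodMk (hrun.measurable_action t)) hg

lemma beforeTransition_le (hrun : IsRun M μ₁ πopt P θ s a ϑ) (t : ℕ) :
    beforeTransition M θ s a ϑ t ≤ ‹MeasurableSpace Ω› := by
  refine sup_le (sup_le (sup_le (sup_le ?_ (sup_le (sup_le ?_ ?_) ?_)) ?_) ?_) ?_
  · exact hrun.measurable_param.comap_le
  · exact iSup₂_le fun τ _ => (hrun.measurable_state τ).comap_le
  · exact iSup₂_le fun τ _ => (hrun.measurable_action τ).comap_le
  · refine iSup₂_le fun τ _ => ?_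
    rw [← BorelSpace.measurable_eq]
    exact (hrun.measurable_reward_comp hrun.measurable_param τ).comap_le
  · exact iSup₂_le fun τ _ => (hrun.measurable_sample τ).comap_le
  · exact (hrun.measurable_sample t).comap_le
  · exact (hrun.measurable_action t).comap_le

lemma observed_le (hrun : IsRun M μ₁ πopt P θ s a ϑ) (t : ℕ) :
    observed M θ s a t ≤ ‹MeasurableSpace Ω› :=
  observed_le_beforeTransition.trans (hrun.beforeTransition_le t)

lemma measurableSet_start (hrun : IsRun M μ₁ πopt P θ s a ϑ) (u : ℕ) :
    MeasurableSet {ω | IsStageStart (fun τ => (s τ ω, a τ ω)) u} :=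
  hrun.observed_le u _ (measurableSet_isStageStart u)

variable [IsProbabilityMeasure P]

/-- Posterior sampling: at the start of a stage, the sampled and the true parameter have the same
joint distribution with the observed history. -/
lemma map_sample_eq (hrun : IsRun M μ₁ πopt P θ s a ϑ) (hu : 1 ≤ u) {ζ : Type*}
    [MeasurableSpace ζ] {Z : Ω → ζ} (hZ : Measurable[observed M θ s a u] Z) :
    (P.restrict {ω | IsStageStart (fun τ => (s τ ω, a τ ω)) u}).map (fun ω => (Z ω, ϑ u ω))
      = (P.restrict {ω | IsStageStart (fun τ => (s τ ω, a τ ω)) u}).map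
        (fun ω => (Z ω, θ ω)) := by
  set U := {ω | IsStageStart (fun τ => (s τ ω, a τ ω)) u} with hUdef
  have hU : MeasurableSet U := hrun.measurableSet_start u
  have hZ' : Measurable Z := hZ.mono (hrun.observed_le u) le_rfl
  have hϑ := hrun.measurable_sample u
  have hθ := hrun.measurable_param
  refine Measure.ext_prod fun {C B} hC hB => ?_
  rw [Measure.map_apply (hZ'.prodMk hϑ) (hC.prod hB), Measure.map_apply (hZ'.prodMk hθ) (hC.prod hB)]
  have hE : MeasurableSet[observed M θ s a u] (Z ⁻¹' C ∩ U) :=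
    @MeasurableSet.inter _ (observed M θ s a u) _ _ (hZ hC) (measurableSet_isStageStart u)
  have hobs : observed M θ s a u ≤ beforeSampling M θ s a ϑ u := le_sup_right.trans le_sup_left
  have hbs : beforeSampling M θ s a ϑ u ≤ ‹MeasurableSpace Ω› :=
    (le_sup_left.trans le_sup_left).trans (hrun.beforeTransition_le u)
  have hEm : MeasurableSet (Z ⁻¹' C ∩ U) := hrun.observed_le u _ hE
  have hset : ∀ g : Ω → Θ, Measurable g → (P.restrict U) ((fun ω => (Z ω, g ω)) ⁻¹' C ×ˢ B)
      = ENNReal.ofReal (∫ ω in Z ⁻¹' C ∩ U, (g ⁻¹' B).indicator (fun _ => (1 : ℝ)) ω ∂P) := by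
    intro g hg
    rw [integral_indicator (hg hB), setIntegral_const, smul_eq_mul, mul_one, measureReal_def,
      ENNReal.ofReal_toReal (measure_ne_top _ _), Measure.restrict_apply (hg hB),
      Measure.restrict_apply ((hZ'.prodMk hg) (hC.prod hB))]
    congr 1
    ext ω
    simp only [Set.mem_inter_iff, Set.mem_preimage, Set.mem_prod]
    tauto
  rw [hset _ hϑ, hset _ hθ]
  congr 1
  have hint : ∀ g : Ω → Θ, Measurable g →
      Integrable ((g ⁻¹' B).indicator fun _ => (1 : ℝ)) P := fun g hg =>
    (integrable_const (1 : ℝ)).indicator (hg hB)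
  -- The set of integration lies in the observed σ-algebra, hence in the larger one before sampling.
  -- Each indicator may therefore be replaced by its own conditional expectation, and on the start
  -- event the two agree.
  rw [← setIntegral_condExp hbs (hint _ hϑ) (hobs _ hE),
    ← setIntegral_condExp (hrun.observed_le u) (hint _ hθ) hE]
  refine setIntegral_congr_ae hEm ?_
  filter_upwards [hrun.sample_start u hu B hB] with ω hω hmem
  exact hω hmem.2

lemma integral_sample_eq (hrun : IsRun M μ₁ πopt P θ s a ϑ) (hu : 1 ≤ u) {ζ : Type*}
    [MeasurableSpace ζ] {Z : Ω → ζ} (hZ : Measurable[observed M θ s a u] Z) {f : ζ × Θ → ℝ}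
    (hf : Measurable f) (h0 : ∀ ω, ¬ IsStageStart (fun τ => (s τ ω, a τ ω)) u →
      f (Z ω, ϑ u ω) = 0 ∧ f (Z ω, θ ω) = 0) :
    ∫ ω, f (Z ω, ϑ u ω) ∂P = ∫ ω, f (Z ω, θ ω) ∂P := by
  have hZ' : Measurable Z := hZ.mono (hrun.observed_le u) le_rfl
  have h := hrun.map_sample_eq hu hZ
  rw [← setIntegral_eq_integral_of_forall_compl_eq_zero
      (s := {ω | IsStageStart (fun τ => (s τ ω, a τ ω)) u}) fun ω hω => (h0 ω hω).1,
    ← setIntegral_eq_integral_of_forall_compl_eq_zero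
      (s := {ω | IsStageStart (fun τ => (s τ ω, a τ ω)) u}) fun ω hω => (h0 ω hω).2,
    ← integral_map (hZ'.prodMk (hrun.measurable_sample u)).aemeasurable
      hf.aestronglyMeasurable,
    ← integral_map (hZ'.prodMk hrun.measurable_param).aemeasurable hf.aestronglyMeasurable, h]

lemma measure_sample_eq (hrun : IsRun M μ₁ πopt P θ s a ϑ) (hu : 1 ≤ u) {ζ : Type*}
    [MeasurableSpace ζ] {Z : Ω → ζ} (hZ : Measurable[observed M θ s a u] Z) {C : Set (ζ × Θ)}
    (hC : MeasurableSet C) :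
    P {ω | IsStageStart (fun τ => (s τ ω, a τ ω)) u ∧ (Z ω, ϑ u ω) ∈ C}
      = P {ω | IsStageStart (fun τ => (s τ ω, a τ ω)) u ∧ (Z ω, θ ω) ∈ C} := by
  have hZ' : Measurable Z := hZ.mono (hrun.observed_le u) le_rfl
  have h := congrArg (fun μ => μ C) (hrun.map_sample_eq hu hZ)
  have hm : ∀ g : Ω → Θ, Measurable g → MeasurableSet ((fun ω => (Z ω, g ω)) ⁻¹' C) :=
    fun g hg => (hZ'.prodMk hg) hC
  simp only [Measure.map_apply (hZ'.prodMk (hrun.measurable_sample u)) hC,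
    Measure.map_apply (hZ'.prodMk hrun.measurable_param) hC,
    Measure.restrict_apply (hm _ (hrun.measurable_sample u)),
    Measure.restrict_apply (hm _ hrun.measurable_param)] at h
  convert h using 2 <;> ext ω <;> exact and_comm

/-- The state after round `t` integrates out to the transition probabilities. -/
lemma integral_next_state (hrun : IsRun M μ₁ πopt P θ s a ϑ) (ht : 1 ≤ t) {f : S → Ω → ℝ}
    (hf : ∀ s', Measurable[beforeTransition M θ s a ϑ t] (f s')) {C : ℝ}
    (hC : ∀ s' ω, |f s' ω| ≤ C) :
    ∫ ω, f (s (t + 1) ω) ω ∂P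
      = ∫ ω, ∑ s', M.trans (θ ω) (s t ω) (a t ω) s' * f s' ω ∂P := by
  classical
  have hle : beforeTransition M θ s a ϑ t ≤ ‹MeasurableSpace Ω› := hrun.beforeTransition_le t
  have hind : ∀ s' : S, Measurable ((s (t + 1) ⁻¹' {s'}).indicator fun _ => (1 : ℝ)) := fun s' =>
    measurable_const.indicator (hrun.measurable_state (t + 1) (measurableSet_singleton s'))
  have hfm : ∀ s', Measurable (f s') := fun s' => (hf s').mono hle le_rfl
  have hint1 : ∀ s', Integrable ((s (t + 1) ⁻¹' {s'}).indicator fun _ => (1 : ℝ)) P := fun s' =>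
    (integrable_const (1 : ℝ)).indicator (hrun.measurable_state (t + 1) (measurableSet_singleton s'))
  have hint2 : ∀ s', Integrable (f s' * (s (t + 1) ⁻¹' {s'}).indicator fun _ => (1 : ℝ)) P :=
    fun s' => (hint1 s').bdd_mul (hfm s').aestronglyMeasurable
      (Eventually.of_forall fun ω => (Real.norm_eq_abs _).trans_le (hC s' ω))
  have key : ∀ s', f s' * P⟦s (t + 1) ⁻¹' {s'} | beforeTransition M θ s a ϑ t⟧ =ᵐ[P]
      fun ω => M.trans (θ ω) (s t ω) (a t ω) s' * f s' ω := by
    intro s'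
    filter_upwards [hrun.transition t ht s'] with ω hω
    rw [Pi.mul_apply, hω, mul_comm]
  have hpull : ∀ s', P[f s' * (s (t + 1) ⁻¹' {s'}).indicator fun _ => (1 : ℝ) |
      beforeTransition M θ s a ϑ t]
      =ᵐ[P] fun ω => M.trans (θ ω) (s t ω) (a t ω) s' * f s' ω := fun s' =>
    (condExp_mul_of_stronglyMeasurable_left (hf s').stronglyMeasurable (hint2 s')
      (hint1 s')).trans (key s')
  have hsum : ∀ ω, f (s (t + 1) ω) ω
      = ∑ s', (f s' * (s (t + 1) ⁻¹' {s'}).indicator fun _ => (1 : ℝ)) ω := by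
    intro ω
    simp [Set.indicator_apply]
  simp only [hsum]
  rw [integral_finsetSum _ fun s' _ => hint2 s', integral_finsetSum]
  · refine Finset.sum_congr rfl fun s' _ => ?_
    rw [← integral_condExp hle]
    exact integral_congr_ae (hpull s')
  · exact fun s' _ => integrable_condExp.congr (hpull s')

end IsRun

end BALSA

/-! ### Concentration of the empirical transitions -/

/-- Hoeffding's lemma for a Bernoulli variable of mean `q`, realized on `Bool`. -/
lemma Real.two_point_hoeffding {q : ℝ} (hq0 : 0 ≤ q) (hq1 : q ≤ 1) (c : ℝ) :
    q * Real.exp (c * (1 - q)) + (1 - q) * Real.exp (c * (0 - q)) ≤ Real.exp (c ^ 2 / 8) := by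
  set μ : Measure Bool := ENNReal.ofReal q • Measure.dirac true
    + ENNReal.ofReal (1 - q) • Measure.dirac false with hμ
  have hint : ∀ f : Bool → ℝ, ∫ b, f b ∂μ = q * f true + (1 - q) * f false := by
    intro f
    rw [hμ, integral_add_measure, integral_smul_measure, integral_smul_measure, integral_dirac,
      integral_dirac, ENNReal.toReal_ofReal hq0, ENNReal.toReal_ofReal (by linarith)]
    · simp
    · exact (integrable_dirac (by simp)).smul_measure ENNReal.ofReal_ne_top
    · exact (integrable_dirac (by simp)).smul_measure ENNReal.ofReal_ne_top
  have hprob : IsProbabilityMeasure μ := ⟨by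
    rw [hμ]
    simp only [Measure.add_apply, Measure.smul_apply, measure_univ, smul_eq_mul, mul_one]
    rw [← ENNReal.ofReal_add hq0 (by linarith)]
    simp⟩
  have h := (hasSubgaussianMGF_of_mem_Icc (μ := μ) (X := fun b => if b then (1 : ℝ) else 0)
    (a := 0) (b := 1) (measurable_of_countable _).aemeasurable
    (Eventually.of_forall fun b => by cases b <;> simp)).mgf_le c
  rw [mgf, hint, hint] at h
  norm_num at h
  calc _ ≤ _ := by simpa using h
    _ = _ := by ring_nf

namespace ParamMDP

variable {S A Θ : Type*} [Fintype S] [MeasurableSpace Θ]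

/-- Probability to move from the pair `p` into the set `B`. -/
noncomputable def transSet (M : ParamMDP S A Θ) (θ : Θ) (p : S × A) (B : Finset S) : ℝ :=
  ∑ s' ∈ B, M.trans θ p.1 p.2 s'

variable (M : ParamMDP S A Θ)

lemma transSet_nonneg (θ : Θ) (p : S × A) (B : Finset S) : 0 ≤ M.transSet θ p B :=
  Finset.sum_nonneg fun s' _ => M.trans_nonneg θ p.1 p.2 s'

lemma transSet_le_one (θ : Θ) (p : S × A) (B : Finset S) : M.transSet θ p B ≤ 1 :=
  (Finset.sum_le_univ_sum_of_nonneg fun s' => M.trans_nonneg θ p.1 p.2 s').trans_eq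
    (M.trans_sum θ p.1 p.2)

lemma measurable_transSet (p : S × A) (B : Finset S) : Measurable fun θ => M.transSet θ p B :=
  Finset.measurable_sum _ fun s' _ => M.measurable_trans p.1 p.2 s'

open Classical in
lemma transSet_compl (θ : Θ) (p : S × A) (B : Finset S) :
    M.transSet θ p Bᶜ = 1 - M.transSet θ p B := by
  rw [eq_sub_iff_add_eq, transSet, transSet, Finset.sum_compl_add_sum]
  exact M.trans_sum θ p.1 p.2

-- Given a visit to `p`, the indicator of a move into `B` is Bernoulli with mean `M.transSet θ p B`.
-- This is the one-step inequality behind the supermartingale of `integral_exp_moves_le`.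
open Classical in
lemma sum_trans_mul_exp_le (θ : Θ) (p : S × A) (B : Finset S) (c : ℝ) :
    ∑ s', M.trans θ p.1 p.2 s' *
      Real.exp (c * ((if s' ∈ B then 1 else 0) - M.transSet θ p B) - c ^ 2 / 8) ≤ 1 := by
  have h := Real.two_point_hoeffding (M.transSet_nonneg θ p B) (M.transSet_le_one θ p B) c
  have hB : ∑ s' ∈ B, M.trans θ p.1 p.2 s' = M.transSet θ p B := rfl
  have hBc : ∑ s' ∈ Bᶜ, M.trans θ p.1 p.2 s' = 1 - M.transSet θ p B := M.transSet_compl θ p B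
  have hsplit : ∑ s', M.trans θ p.1 p.2 s' *
      Real.exp (c * ((if s' ∈ B then 1 else 0) - M.transSet θ p B) - c ^ 2 / 8)
      = (M.transSet θ p B * Real.exp (c * (1 - M.transSet θ p B))
        + (1 - M.transSet θ p B) * Real.exp (c * (0 - M.transSet θ p B))) *
        Real.exp (-(c ^ 2 / 8)) := by
    rw [add_mul, mul_assoc, mul_assoc, ← Real.exp_add, ← Real.exp_add, ← sub_eq_add_neg,
      ← sub_eq_add_neg, ← Finset.sum_add_sum_compl B]
    congr 1
    · nth_rw 2 [← hB]
      rw [Finset.sum_mul]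
      exact Finset.sum_congr rfl fun s' hs' => by rw [if_pos hs']
    · rw [← hBc, Finset.sum_mul]
      exact Finset.sum_congr rfl fun s' hs' => by rw [if_neg (Finset.mem_compl.1 hs')]
  rw [hsplit]
  calc _ ≤ Real.exp (c ^ 2 / 8) * Real.exp (-(c ^ 2 / 8)) := by gcongr
    _ = 1 := by rw [← Real.exp_add]; simp

end ParamMDP

namespace BALSA

section Counts

variable {S A Θ Ω : Type*}

open Classical in
/-- Number of moves from the pair `p` into the set `B` before round `u`. -/
noncomputable def moves (s : ℕ → Ω → S) (a : ℕ → Ω → A) (u : ℕ) (p : S × A) (B : Finset S)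
    (ω : Ω) : ℝ :=
  ∑ τ ∈ Finset.Ico 1 u, if (s τ ω, a τ ω) = p ∧ s (τ + 1) ω ∈ B then 1 else 0

/-- The number of visits as a real number. -/
noncomputable def visitCount (s : ℕ → Ω → S) (a : ℕ → Ω → A) (u : ℕ) (p : S × A) (ω : Ω) : ℝ :=
  visits (fun τ => (s τ ω, a τ ω)) u p

variable (s : ℕ → Ω → S) (a : ℕ → Ω → A) {u : ℕ} (p : S × A) (B : Finset S) (ω : Ω)

open Classical in
lemma visitCount_succ (hu : 1 ≤ u) :
    visitCount s a (u + 1) p ω = visitCount s a u p ω + if (s u ω, a u ω) = p then 1 else 0 := by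
  rw [visitCount, visits_succ _ hu, visitCount]
  push_cast
  rfl

lemma visitCount_nonneg : 0 ≤ visitCount s a u p ω := Nat.cast_nonneg _

lemma visitCount_le : visitCount s a u p ω ≤ u := by
  rw [visitCount]
  exact_mod_cast (visits_le _ u p).trans (Nat.sub_le u 1)

open Classical in
lemma moves_succ (hu : 1 ≤ u) :
    moves s a (u + 1) p B ω
      = moves s a u p B ω + if (s u ω, a u ω) = p ∧ s (u + 1) ω ∈ B then 1 else 0 :=
  Finset.sum_Ico_succ_top hu _

lemma moves_one : moves s a 1 p B ω = 0 := by simp [moves]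

lemma moves_nonneg : 0 ≤ moves s a u p B ω :=
  Finset.sum_nonneg fun τ _ => by split_ifs <;> simp

open Classical in
lemma moves_add_moves_compl [Fintype S] :
    moves s a u p B ω + moves s a u p Bᶜ ω = visitCount s a u p ω := by
  rw [moves, moves, ← Finset.sum_add_distrib, visitCount, visits, Finset.card_filter]
  push_cast
  refine Finset.sum_congr rfl fun τ _ => ?_
  by_cases h1 : (s τ ω, a τ ω) = p <;> by_cases h2 : s (τ + 1) ω ∈ B <;> simp [h1, h2]

lemma moves_le [Fintype S] : moves s a u p B ω ≤ visitCount s a u p ω := by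
  classical
  linarith [moves_add_moves_compl s a (u := u) p B ω, moves_nonneg s a (u := u) p Bᶜ ω]

variable [Fintype S] [MeasurableSpace Θ] [MeasurableSpace S] [MeasurableSingletonClass S]
  [MeasurableSpace A] [MeasurableSingletonClass A] {M : ParamMDP S A Θ} {θ : Ω → Θ}
  {s : ℕ → Ω → S} {a : ℕ → Ω → A}

lemma measurable_visitCount [Countable A] :
    Measurable[observed M θ s a u] (visitCount s a u p) :=
  measurable_observed_of_congr (F := fun x => (visits x u p : ℝ))
    fun x y h => by rw [visits_congr h le_rfl]

lemma measurable_moves [Countable A] : Measurable[observed M θ s a u] (moves s a u p B) := by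
  classical
  refine @Finset.measurable_sum _ _ _ _ _ _ (observed M θ s a u) _ _ fun τ hτ => ?_
  obtain ⟨h1, h2⟩ := Finset.mem_Ico.1 hτ
  have h : Measurable[observed M θ s a u] fun ω => ((s τ ω, a τ ω), s (τ + 1) ω) :=
    (measurable_pair_observed h1 h2).prodMk (measurable_state_observed (by omega) h2)
  exact (Measurable.of_discrete
    (f := fun z : (S × A) × S => if z.1 = p ∧ z.2 ∈ B then (1 : ℝ) else 0)).comp h

end Counts

namespace IsRun

variable {S A Θ Ω : Type*} [Fintype S] [Fintype A] [MeasurableSpace Θ]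
  [MeasurableSpace S] [MeasurableSingletonClass S] [MeasurableSpace A] [MeasurableSingletonClass A]
  [MeasurableSpace Ω] {M : ParamMDP S A Θ} {μ₁ : Measure Θ} {πopt : S → Θ → A} {P : Measure Ω}
  [IsProbabilityMeasure P]
  {θ : Ω → Θ} {s : ℕ → Ω → S} {a : ℕ → Ω → A} {ϑ : ℕ → Ω → Θ} {t u : ℕ}

/-- The exponential supermartingale of the moves from `p` into `B`. -/
lemma integral_exp_moves_le (hrun : IsRun M μ₁ πopt P θ s a ϑ) (p : S × A) (B : Finset S)
    (c : ℝ) (hu : 1 ≤ u) :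
    Integrable (fun ω => Real.exp (c * (moves s a u p B ω
        - visitCount s a u p ω * M.transSet (θ ω) p B) - c ^ 2 / 8 * visitCount s a u p ω)) P ∧
    ∫ ω, Real.exp (c * (moves s a u p B ω
        - visitCount s a u p ω * M.transSet (θ ω) p B) - c ^ 2 / 8 * visitCount s a u p ω) ∂P
      ≤ 1 := by
  classical
  set W : ℕ → Ω → ℝ := fun u ω => Real.exp (c * (moves s a u p B ω
    - visitCount s a u p ω * M.transSet (θ ω) p B) - c ^ 2 / 8 * visitCount s a u p ω) with hW
  have hWm : ∀ u, Measurable[beforeTransition M θ s a ϑ u] (W u) := by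
    intro u
    have h1 : Measurable[beforeTransition M θ s a ϑ u] (moves s a u p B) :=
      (measurable_moves p B).mono observed_le_beforeTransition le_rfl
    have h2 : Measurable[beforeTransition M θ s a ϑ u] (visitCount s a u p) :=
      (measurable_visitCount p).mono observed_le_beforeTransition le_rfl
    have h3 : Measurable[beforeTransition M θ s a ϑ u] fun ω => M.transSet (θ ω) p B :=
      (M.measurable_transSet p B).comp measurable_param_beforeTransition
    exact Real.measurable_exp.comp
      (((h1.sub (h2.mul h3)).const_mul c).sub (h2.const_mul (c ^ 2 / 8)))
  have hWb : ∀ u ω, |W u ω| ≤ Real.exp (|c| * u) := by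
    intro u ω
    rw [abs_of_pos (Real.exp_pos _), Real.exp_le_exp]
    have h1 := moves_nonneg s a (u := u) p B ω
    have h2 := moves_le s a (u := u) p B ω
    have h3 := visitCount_nonneg s a (u := u) p ω
    have h4 := visitCount_le s a (u := u) p ω
    have h5 := M.transSet_nonneg (θ ω) p B
    have h6 := M.transSet_le_one (θ ω) p B
    have h7 : |moves s a u p B ω - visitCount s a u p ω * M.transSet (θ ω) p B| ≤ u := by
      rw [abs_le]
      constructor <;> nlinarith
    have h8 := (le_abs_self (c * (moves s a u p B ω
      - visitCount s a u p ω * M.transSet (θ ω) p B))).trans_eq (abs_mul _ _)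
    nlinarith [mul_le_mul_of_nonneg_left h7 (abs_nonneg c),
      mul_nonneg (show 0 ≤ c ^ 2 / 8 by positivity) h3]
  have hWi : ∀ u, Integrable (W u) P := fun u =>
    Integrable.of_bound ((hWm u).mono (hrun.beforeTransition_le u) le_rfl).aestronglyMeasurable
      _ (Eventually.of_forall fun ω => (Real.norm_eq_abs _).trans_le (hWb u ω))
  refine ⟨hWi u, ?_⟩
  induction u, hu using Nat.le_induction with
  | base => simp [visitCount, visits_one, moves_one]
  | succ u hu ih =>
    -- Round `u` multiplies `W u` by a factor that is `1` unless `p` is played; integrating out the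
    -- next state leaves a mean factor of at most `1`.
    refine Eq.trans_le (b := ∫ ω, ∑ s', M.trans (θ ω) (s u ω) (a u ω) s' * (W u ω *
        Real.exp (if (s u ω, a u ω) = p then
          c * ((if s' ∈ B then 1 else 0) - M.transSet (θ ω) p B) - c ^ 2 / 8 else 0)) ∂P)
      ?_ (le_trans ?_ ih)
    · rw [← hrun.integral_next_state hu (f := fun s' ω => W u ω *
        Real.exp (if (s u ω, a u ω) = p then
          c * ((if s' ∈ B then 1 else 0) - M.transSet (θ ω) p B) - c ^ 2 / 8 else 0))
        (C := Real.exp (|c| * u) * Real.exp |c|)]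
      · refine integral_congr_ae (Eventually.of_forall fun ω => ?_)
        simp only [hW]
        rw [← Real.exp_add, moves_succ s a p B ω hu, visitCount_succ s a p ω hu]
        congr 1
        by_cases h1 : (s u ω, a u ω) = p <;> by_cases h2 : s (u + 1) ω ∈ B <;>
          simp only [h1, h2, if_true, if_false, and_true, and_false, and_self] <;> ring
      · intro s'
        refine (hWm u).mul (Real.measurable_exp.comp ?_)
        refine Measurable.ite (measurable_pair_beforeTransition hu (measurableSet_singleton p)) ?_
          measurable_const
        exact (((M.measurable_transSet p B).comp measurable_param_beforeTransition).const_sub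
          _).const_mul c |>.sub_const _
      · intro s' ω
        rw [abs_mul]
        refine mul_le_mul (hWb u ω) ?_ (abs_nonneg _) (Real.exp_pos _).le
        rw [abs_of_pos (Real.exp_pos _), Real.exp_le_exp]
        have h5 := M.transSet_nonneg (θ ω) p B
        have h6 := M.transSet_le_one (θ ω) p B
        have h7 : |(if s' ∈ B then (1 : ℝ) else 0) - M.transSet (θ ω) p B| ≤ 1 := by
          rw [abs_le]
          split_ifs <;> constructor <;> linarith
        have h8 := (le_abs_self (c * ((if s' ∈ B then (1 : ℝ) else 0)
          - M.transSet (θ ω) p B))).trans_eq (abs_mul _ _)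
        split_ifs at * <;>
          nlinarith [abs_nonneg c, mul_le_mul_of_nonneg_left h7 (abs_nonneg c), sq_nonneg c]
    · refine integral_mono_of_nonneg (Eventually.of_forall fun ω => ?_) (hWi u)
        (Eventually.of_forall fun ω => ?_)
      · exact Finset.sum_nonneg fun s' _ => mul_nonneg (M.trans_nonneg _ _ _ _)
          (mul_nonneg (Real.exp_pos _).le (Real.exp_pos _).le)
      · simp only
        by_cases h1 : (s u ω, a u ω) = p
        · simp only [h1, if_true]
          have h2 := M.sum_trans_mul_exp_le (θ ω) (s u ω, a u ω) B c
          dsimp only at h2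
          rw [h1] at h2
          have h3 : ∀ s', M.trans (θ ω) (s u ω) (a u ω) s' * (W u ω * Real.exp
              (c * ((if s' ∈ B then 1 else 0) - M.transSet (θ ω) p B) - c ^ 2 / 8))
              = W u ω * (M.trans (θ ω) (s u ω) (a u ω) s' * Real.exp
              (c * ((if s' ∈ B then 1 else 0) - M.transSet (θ ω) p B) - c ^ 2 / 8)) :=
            fun s' => by ring
          simp only [h3]
          rw [← Finset.mul_sum]
          exact mul_le_of_le_one_right (Real.exp_pos _).le h2
        · simp only [h1, if_false, Real.exp_zero, mul_one]
          rw [← Finset.sum_mul, M.trans_sum, one_mul]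

end IsRun

/-- The parameter `ϑ` contradicts the moves before round `u` at confidence level `L`. -/
def Implausible {S A Θ Ω : Type*} [Fintype S] [MeasurableSpace Θ] (M : ParamMDP S A Θ)
    (s : ℕ → Ω → S) (a : ℕ → Ω → A) (L : ℝ) (u : ℕ) (ϑ : Θ) (ω : Ω) : Prop :=
  ∃ p B, 0 < visitCount s a u p ω ∧ √(visitCount s a u p ω * L / 2)
    < moves s a u p B ω - visitCount s a u p ω * M.transSet ϑ p B

namespace IsRun

variable {S A Θ Ω : Type*} [Fintype S] [Fintype A] [MeasurableSpace Θ]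
  [MeasurableSpace S] [MeasurableSingletonClass S] [MeasurableSpace A] [MeasurableSingletonClass A]
  [MeasurableSpace Ω] {M : ParamMDP S A Θ} {μ₁ : Measure Θ} {πopt : S → Θ → A} {P : Measure Ω}
  {θ : Ω → Θ} {s : ℕ → Ω → S} {a : ℕ → Ω → A} {ϑ : ℕ → Ω → Θ} {t u : ℕ}

lemma measurableSet_implausible (hrun : IsRun M μ₁ πopt P θ s a ϑ) (L : ℝ) (u : ℕ) {g : Ω → Θ}
    (hg : Measurable g) : MeasurableSet {ω | Implausible M s a L u (g ω) ω} := by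
  have h1 : ∀ p, Measurable (visitCount s a u p) := fun p =>
    (measurable_visitCount (M := M) (θ := θ) p).mono (hrun.observed_le u) le_rfl
  have h2 : ∀ p B, Measurable (moves s a u p B) := fun p B =>
    (measurable_moves (M := M) (θ := θ) p B).mono (hrun.observed_le u) le_rfl
  have h3 : ∀ p B, Measurable fun ω => M.transSet (g ω) p B := fun p B =>
    (M.measurable_transSet p B).comp hg
  have heq : {ω | Implausible M s a L u (g ω) ω} = ⋃ p, ⋃ B, ({ω | 0 < visitCount s a u p ω} ∩
      {ω | √(visitCount s a u p ω * L / 2)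
        < moves s a u p B ω - visitCount s a u p ω * M.transSet (g ω) p B}) := by
    ext ω
    simp [Implausible]
  rw [heq]
  refine MeasurableSet.iUnion fun p => MeasurableSet.iUnion fun B =>
    (measurableSet_lt measurable_const (h1 p)).inter (measurableSet_lt ?_ ?_)
  · exact Real.continuous_sqrt.measurable.comp (((h1 p).mul_const L).div_const 2)
  · exact (h2 p B).sub ((h1 p).mul (h3 p B))

variable [IsProbabilityMeasure P]

lemma measure_moves_le (hrun : IsRun M μ₁ πopt P θ s a ϑ) (p : S × A) (B : Finset S) {L : ℝ}
    (hL : 0 ≤ L) (hu : 1 ≤ u) {m : ℕ} (hm : 1 ≤ m) :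
    P.real {ω | visitCount s a u p ω = m ∧ √(m * L / 2)
      < moves s a u p B ω - m * M.transSet (θ ω) p B} ≤ Real.exp (-L) := by
  have hm' : (0 : ℝ) < m := by exact_mod_cast hm
  set e := √(m * L / 2) with he
  have he2 : e ^ 2 = m * L / 2 := Real.sq_sqrt (by positivity)
  -- The maximizer of `c * e - c ^ 2 / 8 * m`; the maximum `2 * e ^ 2 / m` equals `L`.
  set c := 4 * e / m with hc
  have hc0 : 0 ≤ c := by positivity
  obtain ⟨hint, hle⟩ := hrun.integral_exp_moves_le p B c hu
  have hmarkov := mul_meas_ge_le_integral_of_nonneg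
    (Eventually.of_forall fun ω => (Real.exp_pos _).le) hint (Real.exp L)
  have hsub : P.real {ω | visitCount s a u p ω = m ∧ e
      < moves s a u p B ω - m * M.transSet (θ ω) p B} ≤ P.real {ω | Real.exp L ≤
        Real.exp (c * (moves s a u p B ω - visitCount s a u p ω * M.transSet (θ ω) p B)
          - c ^ 2 / 8 * visitCount s a u p ω)} := by
    refine measureReal_mono fun ω hω => ?_
    obtain ⟨h1, h2⟩ := hω
    change Real.exp L ≤ _
    rw [h1, Real.exp_le_exp]
    have h3 : c * e - c ^ 2 / 8 * m = L := by
      have : c * e - c ^ 2 / 8 * m = 2 * e ^ 2 / m := by rw [hc]; field_simp; ring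
      rw [this, he2]
      field_simp
    nlinarith
  rw [Real.exp_neg, ← one_div, le_div_iff₀ (Real.exp_pos L)]
  nlinarith [Real.exp_pos L]

lemma measure_implausible_le (hrun : IsRun M μ₁ πopt P θ s a ϑ) {L : ℝ} (hL : 0 ≤ L)
    (hu : 1 ≤ u) :
    P.real {ω | Implausible M s a L u (θ ω) ω}
      ≤ Fintype.card S * Fintype.card A * 2 ^ Fintype.card S * u * Real.exp (-L) := by
  classical
  -- The visit count is random, so the union bound also runs over its possible positive values.
  let I : Finset ((S × A) × Finset S × ℕ) := Finset.univ ×ˢ Finset.univ ×ˢ Finset.Icc 1 u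
  calc P.real {ω | Implausible M s a L u (θ ω) ω}
      ≤ P.real (⋃ i ∈ I, {ω | visitCount s a u i.1 ω = i.2.2 ∧ √(i.2.2 * L / 2)
        < moves s a u i.1 i.2.1 ω - i.2.2 * M.transSet (θ ω) i.1 i.2.1}) := by
        refine measureReal_mono (fun ω hω => ?_) (measure_ne_top _ _)
        obtain ⟨p, B, hpos, hlt⟩ := hω
        simp only [Set.mem_iUnion]
        refine ⟨(p, B, visits (fun τ => (s τ ω, a τ ω)) u p), ?_, rfl, hlt⟩
        have h1 : 0 < visits (fun τ => (s τ ω, a τ ω)) u p := Nat.cast_pos.1 hpos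
        have h2 := visits_le (fun τ => (s τ ω, a τ ω)) u p
        simp only [I, Finset.mem_product, Finset.mem_univ, true_and, Finset.mem_Icc]
        omega
    _ ≤ ∑ i ∈ I, Real.exp (-L) := by
        refine (measureReal_biUnion_finset_le _ _).trans (Finset.sum_le_sum fun i hi => ?_)
        simp only [I, Finset.mem_product, Finset.mem_univ, true_and, Finset.mem_Icc] at hi
        exact hrun.measure_moves_le i.1 i.2.1 hL hu hi.1
    _ = _ := by
        simp only [I, Finset.sum_const, Finset.card_product, Finset.card_univ, Fintype.card_prod,
          Fintype.card_finset, Nat.card_Icc, nsmul_eq_mul, Nat.add_sub_cancel]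
        push_cast
        ring

/-- A sampled parameter is as plausible as the true one. -/
lemma measure_implausible_sample (hrun : IsRun M μ₁ πopt P θ s a ϑ) (L : ℝ) (hu : 1 ≤ u) :
    P {ω | IsStageStart (fun τ => (s τ ω, a τ ω)) u ∧ Implausible M s a L u (ϑ u ω) ω}
      = P {ω | IsStageStart (fun τ => (s τ ω, a τ ω)) u ∧ Implausible M s a L u (θ ω) ω} := by
  let Z : Ω → (S × A → ℝ) × (S × A → Finset S → ℝ) := fun ω =>
    (fun p => visitCount s a u p ω, fun p B => moves s a u p B ω)
  have hZ : Measurable[observed M θ s a u] Z := by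
    refine Measurable.prodMk ?_ ?_
    · exact @measurable_pi_lambda _ _ _ (observed M θ s a u) _ _ fun p => measurable_visitCount p
    · exact @measurable_pi_lambda _ _ _ (observed M θ s a u) _ _ fun p =>
        @measurable_pi_lambda _ _ _ (observed M θ s a u) _ _ fun B => measurable_moves p B
  let C : Set (((S × A → ℝ) × (S × A → Finset S → ℝ)) × Θ) :=
    ⋃ p, ⋃ B, ({z | 0 < z.1.1 p} ∩
      {z | √(z.1.1 p * L / 2) < z.1.2 p B - z.1.1 p * M.transSet z.2 p B})
  have hC : MeasurableSet C := by
    have h3 : ∀ p B, Measurable fun z : ((S × A → ℝ) × (S × A → Finset S → ℝ)) × Θ =>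
        M.transSet z.2 p B := fun p B => (M.measurable_transSet p B).comp measurable_snd
    refine MeasurableSet.iUnion fun p => MeasurableSet.iUnion fun B =>
      (measurableSet_lt measurable_const (by fun_prop)).inter (measurableSet_lt (by fun_prop) ?_)
    have := h3 p B
    fun_prop
  have h := hrun.measure_sample_eq hu hZ hC
  have hmem : ∀ ϑ' ω, (Z ω, ϑ') ∈ C ↔ Implausible M s a L u ϑ' ω := by
    intro ϑ' ω
    simp [C, Z, Implausible]
  simpa only [hmem] using h

end IsRun

end BALSA

/-! ### Consequences of the Bellman equation -/

namespace ParamMDP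

section Bellman

variable {S A Θ : Type*} [Fintype S] [MeasurableSpace Θ] {M : ParamMDP S A Θ}
  {J : Θ → ℝ} {v : S → Θ → ℝ} {πopt : S → Θ → A} {H : ℝ}

lemma sum_trans_mul_le {θ : Θ} {s : S} {a : A} {w : S → ℝ} (hw : ∀ s, w s ≤ H) :
    ∑ s', M.trans θ s a s' * w s' ≤ H := by
  calc _ ≤ ∑ s', M.trans θ s a s' * H := Finset.sum_le_sum fun s' _ =>
        mul_le_mul_of_nonneg_left (hw s') (M.trans_nonneg θ s a s')
    _ = H := by rw [← Finset.sum_mul, M.trans_sum, one_mul]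

lemma le_sum_trans_mul {θ : Θ} {s : S} {a : A} {w : S → ℝ} (hw : ∀ s, H ≤ w s) :
    H ≤ ∑ s', M.trans θ s a s' * w s' := by
  calc H = ∑ s', M.trans θ s a s' * H := by rw [← Finset.sum_mul, M.trans_sum, one_mul]
    _ ≤ _ := Finset.sum_le_sum fun s' _ =>
        mul_le_mul_of_nonneg_left (hw s') (M.trans_nonneg θ s a s')

variable [Finite A]

lemma IsValueFunction.bellmanValue_le (hv : M.IsValueFunction J v) (θ : Θ) (s : S) (a : A) :
    M.bellmanValue θ (fun s' => v s' θ) s a ≤ J θ + v s θ := by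
  rw [hv.bellman]
  exact le_ciSup (Set.finite_range _).bddAbove a

lemma IsValueFunction.bellmanValue_opt (hv : M.IsValueFunction J v)
    (hπ : M.IsOptimalPolicy v πopt) (θ : Θ) (s : S) :
    M.bellmanValue θ (fun s' => v s' θ) s (πopt s θ) = J θ + v s θ := by
  refine (hv.bellmanValue_le θ s _).antisymm ?_
  rw [hv.bellman]
  have : Nonempty A := ⟨πopt s θ⟩
  exact ciSup_le (hπ θ s)

/-- In the Bellman equation at a minimizer of `v` the mean of `v` is at least its value there, so `J
θ` is at least a reward; at a maximizer it is at most one. -/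
lemma IsValueFunction.mem_Icc [Nonempty S] (hv : M.IsValueFunction J v)
    (hπ : M.IsOptimalPolicy v πopt) (θ : Θ) : J θ ∈ Set.Icc (0 : ℝ) 1 := by
  obtain ⟨s₁, h₁⟩ := Finite.exists_min fun s => v s θ
  obtain ⟨s₂, h₂⟩ := Finite.exists_max fun s => v s θ
  have e₁ := hv.bellmanValue_opt hπ θ s₁
  have e₂ := hv.bellmanValue_opt hπ θ s₂
  rw [bellmanValue] at e₁ e₂
  have b₁ := le_sum_trans_mul (M := M) (θ := θ) (s := s₁) (a := πopt s₁ θ) h₁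
  have b₂ := sum_trans_mul_le (M := M) (θ := θ) (s := s₂) (a := πopt s₂ θ) h₂
  have r₁ := (M.reward_mem θ s₁ (πopt s₁ θ)).1
  have r₂ := (M.reward_mem θ s₂ (πopt s₂ θ)).2
  exact ⟨by linarith, by linarith⟩

lemma IsValueFunction.measurable [Nonempty S] [MeasurableSpace A] [MeasurableSingletonClass A]
    (hv : M.IsValueFunction J v) (hv_meas : ∀ s, Measurable (v s))
    (hπ_meas : ∀ s, Measurable (πopt s)) (hπ : M.IsOptimalPolicy v πopt) : Measurable J := by
  obtain ⟨s₀⟩ := ‹Nonempty S›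
  have h : J = fun θ => M.bellmanValue θ (fun s' => v s' θ) s₀ (πopt s₀ θ) - v s₀ θ := by
    funext θ
    rw [hv.bellmanValue_opt hπ]
    ring
  rw [h]
  refine Measurable.sub ?_ (hv_meas s₀)
  exact BALSA.measurable_apply_of_countable
    (f := fun a θ => M.bellmanValue θ (fun s' => v s' θ) s₀ a)
    (fun a => (M.measurable_reward s₀ a).add (Finset.measurable_sum _ fun s' _ =>
      (M.measurable_trans s₀ a s').mul (hv_meas s'))) (hπ_meas s₀) measurable_id

end Bellman

end ParamMDP

/-! ### Errors of the sampled model along a path -/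

namespace BALSA

section Plausible

variable {S A Θ Ω : Type*} [Fintype S] [MeasurableSpace Θ] {M : ParamMDP S A Θ}
  {s : ℕ → Ω → S} {a : ℕ → Ω → A} {u : ℕ} {L H : ℝ} {ω : Ω}

/-- Since `0 ≤ w ≤ H`, only the set `B` where `θ₁` has the larger probabilities matters.
Implausibility is one-sided but concerns all sets: plausibility of `θ₂` on `B` and of `θ₁` on `Bᶜ`
bounds the difference on `B` from above. -/
lemma sum_trans_sub_mul_le_of_plausible {θ₁ θ₂ : Θ} {p : S × A} {w : S → ℝ}
    (h₁ : ¬ Implausible M s a L u θ₁ ω) (h₂ : ¬ Implausible M s a L u θ₂ ω)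
    (hw0 : ∀ s, 0 ≤ w s) (hwH : ∀ s, w s ≤ H) (hL : 0 ≤ L) {m : ℕ} (hm : 0 < m)
    (hmu : m ≤ 2 * visits (fun τ => (s τ ω, a τ ω)) u p) :
    ∑ s', (M.trans θ₁ p.1 p.2 s' - M.trans θ₂ p.1 p.2 s') * w s'
      ≤ H * (2 * √L * (1 / √(m : ℝ))) := by
  classical
  set N := visitCount s a u p ω with hN
  have hm' : (0 : ℝ) < m := by exact_mod_cast hm
  have hmN : (m : ℝ) ≤ 2 * N := by rw [hN, visitCount]; exact_mod_cast hmu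
  have hN0 : 0 < N := by linarith
  set B : Finset S := Finset.univ.filter fun s' => M.trans θ₂ p.1 p.2 s' ≤ M.trans θ₁ p.1 p.2 s'
  have hB : ∑ s', (M.trans θ₁ p.1 p.2 s' - M.trans θ₂ p.1 p.2 s') * w s'
      ≤ H * (M.transSet θ₁ p B - M.transSet θ₂ p B) := by
    rw [ParamMDP.transSet, ParamMDP.transSet, ← Finset.sum_sub_distrib, Finset.mul_sum,
      Finset.sum_filter]
    refine Finset.sum_le_sum fun s' _ => ?_
    split_ifs with hs
    · nlinarith [hwH s']
    · nlinarith [hw0 s']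
  simp only [Implausible, not_exists, not_and, not_lt] at h₁ h₂
  have e₁ := h₁ p Bᶜ hN0
  have e₂ := h₂ p B hN0
  have hmoves := moves_add_moves_compl s a (u := u) p B ω
  rw [M.transSet_compl, ← hN] at e₁
  rw [← hN] at e₂ hmoves
  -- This trades the count `N` at the start of the stage for the current count `m ≤ 2 * N`, so that
  -- the bounds can be summed over rounds.
  have hsqrt : √(N * L / 2) * √(m : ℝ) ≤ N * √L := by
    rw [← Real.sqrt_mul (by positivity)]
    refine Real.sqrt_le_iff.2 ⟨by positivity, ?_⟩
    rw [mul_pow, Real.sq_sqrt hL]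
    nlinarith [mul_le_mul_of_nonneg_left hmN (show 0 ≤ N * L / 2 by positivity)]
  have hroot : 0 < √(m : ℝ) := Real.sqrt_pos.2 hm'
  have hdiff : M.transSet θ₁ p B - M.transSet θ₂ p B ≤ 2 * √L * (1 / √(m : ℝ)) := by
    rw [mul_one_div, le_div_iff₀ hroot]
    refine le_of_mul_le_mul_left ?_ hN0
    have h3 : N * (M.transSet θ₁ p B - M.transSet θ₂ p B) ≤ 2 * √(N * L / 2) := by nlinarith
    nlinarith
  obtain ⟨s₀⟩ : Nonempty S := ⟨p.1⟩
  exact hB.trans (mul_le_mul_of_nonneg_left hdiff ((hw0 s₀).trans (hwH s₀)))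

end Plausible

namespace IsRun

variable {S A Θ Ω : Type*} [Fintype S] [Fintype A] [MeasurableSpace Θ]
  [MeasurableSpace S] [MeasurableSingletonClass S] [MeasurableSpace A] [MeasurableSingletonClass A]
  [MeasurableSpace Ω] {M : ParamMDP S A Θ} {μ₁ : Measure Θ} {πopt : S → Θ → A} {P : Measure Ω}
  [IsProbabilityMeasure P]
  {θ : Ω → Θ} {s : ℕ → Ω → S} {a : ℕ → Ω → A} {ϑ : ℕ → Ω → Θ} {t u : ℕ}

/-- A sampled parameter explains the rewards observed before it was drawn. -/
lemma ae_reward_eq (hrun : IsRun M μ₁ πopt P θ s a ϑ) :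
    ∀ᵐ ω ∂P, ∀ u, 1 ≤ u → IsStageStart (fun τ => (s τ ω, a τ ω)) u →
      ∀ p : S × A, visits (fun τ => (s τ ω, a τ ω)) u p ≠ 0 →
        M.reward (ϑ u ω) p.1 p.2 = M.reward (θ ω) p.1 p.2 := by
  classical
  rw [ae_all_iff]
  intro u
  rw [eventually_imp_distrib_left]
  intro hu
  suffices h : ∀ p : S × A, ∀ᵐ ω ∂P, IsStageStart (fun τ => (s τ ω, a τ ω)) u →
      visits (fun τ => (s τ ω, a τ ω)) u p ≠ 0 →
        M.reward (ϑ u ω) p.1 p.2 = M.reward (θ ω) p.1 p.2 by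
    filter_upwards [ae_all_iff.2 h] with ω hω hstart p using hω p hstart
  intro p
  -- The total reward collected at `p` is observed and equals the visit count times the reward under
  -- `θ`. The event that a parameter violates this identity is null for the truth, hence for the
  -- sample.
  let R : Ω → ℝ := fun ω => ∑ τ ∈ Finset.Ico 1 u,
    (if (s τ ω, a τ ω) = p then 1 else 0) * M.reward (θ ω) (s τ ω) (a τ ω)
  have hR : ∀ ω, R ω = visitCount s a u p ω * M.reward (θ ω) p.1 p.2 := by
    intro ω
    simp only [R]
    rw [visitCount, visits, Finset.card_filter]
    push_cast
    rw [Finset.sum_mul]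
    refine Finset.sum_congr rfl fun τ _ => ?_
    split_ifs with h
    · rw [← h]
    · simp
  have hRm : Measurable[observed M θ s a u] R := by
    refine @Finset.measurable_sum _ _ _ _ _ _ (observed M θ s a u) _ _ fun τ hτ => ?_
    obtain ⟨h1, h2⟩ := Finset.mem_Ico.1 hτ
    exact ((Measurable.of_discrete (f := fun z : S × A => if z = p then (1 : ℝ) else 0)).comp
      (measurable_pair_observed h1 h2)).mul (measurable_reward_observed h1 h2)
  let C : Set ((ℝ × ℝ) × Θ) := {z | z.1.1 * M.reward z.2 p.1 p.2 ≠ z.1.2}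
  have hC : MeasurableSet C := by
    have h : Measurable fun z : (ℝ × ℝ) × Θ => M.reward z.2 p.1 p.2 :=
      (M.measurable_reward p.1 p.2).comp measurable_snd
    exact (measurableSet_eq_fun (by fun_prop) (by fun_prop)).compl
  have hnull := hrun.measure_sample_eq hu
    ((measurable_visitCount (M := M) (θ := θ) (u := u) p).prodMk hRm) hC
  have hempty : {ω | IsStageStart (fun τ => (s τ ω, a τ ω)) u ∧
      ((visitCount s a u p ω, R ω), θ ω) ∈ C} = ∅ := by
    ext ω
    simp [C, hR]
  rw [hempty, measure_empty] at hnull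
  rw [ae_iff]
  refine measure_mono_null (fun ω hω => ?_) hnull
  change ¬ (_ → _ → _) at hω
  push Not at hω
  obtain ⟨h1, h2, h3⟩ := hω
  refine ⟨h1, ?_⟩
  simp only [C, Set.mem_ofPred, hR]
  intro h
  refine h3 (mul_left_cancel₀ (a := visitCount s a u p ω) ?_ h)
  rw [visitCount]
  exact_mod_cast h2

end IsRun

section Values

variable {S A Θ Ω : Type*} {v : S → Θ → ℝ} {H : ℝ} {s : ℕ → Ω → S} {a : ℕ → Ω → A}
  {ϑ : ℕ → Ω → Θ} {ω : Ω} {T : ℕ}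

/-- The sum telescopes while the parameter is kept; each change of parameter costs at most `H`, and
the two ends cost another `H`. -/
lemma sum_value_sub_le (hv_nonneg : ∀ θ s, 0 ≤ v s θ) (hv_le : ∀ θ s, v s θ ≤ H) (hH : 0 ≤ H)
    (hkeep : ∀ t, 1 ≤ t → ¬ IsStageStart (fun τ => (s τ ω, a τ ω)) (t + 1) →
      ϑ (t + 1) ω = ϑ t ω) {K : ℕ} (hT : T < stageStart (fun τ => (s τ ω, a τ ω)) (K + 1)) :
    ∑ t ∈ Finset.Icc 1 T, (v (s (t + 1) ω) (ϑ t ω) - v (s t ω) (ϑ t ω)) ≤ H * K + H := by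
  classical
  have hterm : ∀ t ∈ Finset.Icc 1 T, v (s (t + 1) ω) (ϑ t ω) - v (s t ω) (ϑ t ω)
      ≤ (v (s (t + 1) ω) (ϑ (t + 1) ω) - v (s t ω) (ϑ t ω))
        + H * (if IsStageStart (fun τ => (s τ ω, a τ ω)) (t + 1) then 1 else 0) := by
    intro t ht
    split_ifs with h
    · linarith [hv_nonneg (ϑ (t + 1) ω) (s (t + 1) ω), hv_le (ϑ t ω) (s (t + 1) ω)]
    · rw [hkeep t (Finset.mem_Icc.1 ht).1 h]
      linarith
  refine (Finset.sum_le_sum hterm).trans ?_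
  rw [Finset.sum_add_distrib, ← Finset.mul_sum, Finset.sum_boole,
    ← Finset.Ico_add_one_right_eq_Icc, Finset.sum_Ico_sub (fun t => v (s t ω) (ϑ t ω)) (by omega)]
  have h1 := card_isStageStart_succ_le hT
  have h2 : ((Finset.Ico 1 (T + 1)).filter fun t =>
      IsStageStart (fun τ => (s τ ω, a τ ω)) (t + 1)).card ≤ K := by
    rw [← Set.ncard_coe_finset]
    convert h1 using 2
    ext t
    simp
  have h3 : (((Finset.Ico 1 (T + 1)).filter fun t =>
      IsStageStart (fun τ => (s τ ω, a τ ω)) (t + 1)).card : ℝ) ≤ K := by exact_mod_cast h2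
  have h4 := mul_le_mul_of_nonneg_left h3 hH
  linarith [hv_nonneg (ϑ 1 ω) (s 1 ω), hv_le (ϑ (T + 1) ω) (s (T + 1) ω)]

end Values

section Pathwise

variable {S A Θ Ω : Type*} [Fintype S] [MeasurableSpace Θ] {M : ParamMDP S A Θ}
  {J : Θ → ℝ} {v : S → Θ → ℝ} {πopt : S → Θ → A} {H L : ℝ} {θ : Ω → Θ} {s : ℕ → Ω → S}
  {a : ℕ → Ω → A} {ϑ : ℕ → Ω → Θ} {ω : Ω} {T : ℕ}

/-- The deviation of the value of the next state from its conditional expectation. -/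
noncomputable def valueNoise (M : ParamMDP S A Θ) (v : S → Θ → ℝ) (θ : Ω → Θ) (s : ℕ → Ω → S)
    (a : ℕ → Ω → A) (g : Ω → Θ) (t : ℕ) (ω : Ω) : ℝ :=
  ∑ s', M.trans (θ ω) (s t ω) (a t ω) s' * v s' (g ω) - v (s (t + 1) ω) (g ω)

open Classical in
/-- Number of implausible (sampled or true) parameters at the stage starts up to round `T`. -/
noncomputable def implausibleCount (M : ParamMDP S A Θ) (θ : Ω → Θ) (s : ℕ → Ω → S)
    (a : ℕ → Ω → A) (ϑ : ℕ → Ω → Θ) (L : ℝ) (T : ℕ) (ω : Ω) : ℝ :=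
  ∑ u ∈ Finset.Icc 1 T,
    ({ω | IsStageStart (fun τ => (s τ ω, a τ ω)) u ∧
        Implausible M s a L u (ϑ u ω) ω}.indicator (fun _ => (1 : ℝ)) ω
      + {ω | IsStageStart (fun τ => (s τ ω, a τ ω)) u ∧
        Implausible M s a L u (θ ω) ω}.indicator (fun _ => (1 : ℝ)) ω)

lemma implausibleCount_nonneg : 0 ≤ implausibleCount M θ s a ϑ L T ω :=
  Finset.sum_nonneg fun _ _ => add_nonneg (Set.indicator_nonneg (fun _ _ => zero_le_one) _)
    (Set.indicator_nonneg (fun _ _ => zero_le_one) _)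

lemma one_le_implausibleCount {u : ℕ} (hu : u ∈ Finset.Icc 1 T)
    (hstart : IsStageStart (fun τ => (s τ ω, a τ ω)) u)
    (h : Implausible M s a L u (ϑ u ω) ω ∨ Implausible M s a L u (θ ω) ω) :
    1 ≤ implausibleCount M θ s a ϑ L T ω := by
  have hnn : ∀ (U : Set Ω), 0 ≤ U.indicator (fun _ => (1 : ℝ)) ω := fun U =>
    Set.indicator_nonneg (fun _ _ => zero_le_one) _
  refine le_trans ?_ (Finset.single_le_sum (fun u _ => add_nonneg (hnn _) (hnn _)) hu)
  rcases h with h | h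
  · exact le_add_of_le_of_nonneg
      (Set.indicator_of_mem (s := {ω | IsStageStart (fun τ => (s τ ω, a τ ω)) u ∧
        Implausible M s a L u (ϑ u ω) ω}) ⟨hstart, h⟩
        fun _ => (1 : ℝ)).ge (hnn _)
  · exact le_add_of_nonneg_of_le (hnn _)
      (Set.indicator_of_mem (s := {ω | IsStageStart (fun τ => (s τ ω, a τ ω)) u ∧
        Implausible M s a L u (θ ω) ω}) ⟨hstart, h⟩
        fun _ => (1 : ℝ)).ge

-- A pair visited before the current stage has the same reward in both models. For other rounds the
-- visit count of the pair is still zero: a stage ends once a new pair has been played.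
open Classical in
lemma sum_reward_sub_le
    (hkeep : ∀ t, 1 ≤ t → ¬ IsStageStart (fun τ => (s τ ω, a τ ω)) (t + 1) →
      ϑ (t + 1) ω = ϑ t ω)
    (hrew : ∀ u, 1 ≤ u → IsStageStart (fun τ => (s τ ω, a τ ω)) u →
      ∀ p : S × A, visits (fun τ => (s τ ω, a τ ω)) u p ≠ 0 →
        M.reward (ϑ u ω) p.1 p.2 = M.reward (θ ω) p.1 p.2) :
    ∑ t ∈ Finset.Icc 1 T, (M.reward (ϑ t ω) (s t ω) (a t ω) - M.reward (θ ω) (s t ω) (a t ω))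
      ≤ ((Finset.Icc 1 T).filter fun t =>
          visits (fun τ => (s τ ω, a τ ω)) t (s t ω, a t ω) = 0).card := by
  rw [← Finset.sum_boole]
  refine Finset.sum_le_sum fun t ht => ?_
  obtain ⟨ht1, htT⟩ := Finset.mem_Icc.1 ht
  split_ifs with hnew
  · linarith [(M.reward_mem (ϑ t ω) (s t ω) (a t ω)).2, (M.reward_mem (θ ω) (s t ω) (a t ω)).1]
  · obtain ⟨u, hu1, hut, hstart, hvis, hconst⟩ :=
      exists_current_start (fun τ => (s τ ω, a τ ω)) ht1
    have hϑ : ϑ t ω = ϑ u ω := hconst (fun t => ϑ t ω) hkeep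
    have h := hvis (s t ω, a t ω)
    rw [hϑ, hrew u hu1 hstart (s t ω, a t ω) (by omega), sub_self]

variable [Fintype A]

-- If a parameter was implausible at some stage start, the trivial bound `H` per round is covered by
-- `implausibleCount ≥ 1`. Otherwise the plausibility estimate applies in every round whose pair is
-- not new.
open Classical in
lemma sum_trans_sub_le (hv_nonneg : ∀ θ s, 0 ≤ v s θ) (hv_le : ∀ θ s, v s θ ≤ H) (hH : 0 ≤ H)
    (hL : 0 ≤ L)
    (hkeep : ∀ t, 1 ≤ t → ¬ IsStageStart (fun τ => (s τ ω, a τ ω)) (t + 1) →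
      ϑ (t + 1) ω = ϑ t ω) :
    ∑ t ∈ Finset.Icc 1 T, ∑ s', (M.trans (ϑ t ω) (s t ω) (a t ω) s'
        - M.trans (θ ω) (s t ω) (a t ω) s') * v s' (ϑ t ω)
      ≤ H * T * implausibleCount M θ s a ϑ L T ω
        + H * ((Finset.Icc 1 T).filter fun t =>
          visits (fun τ => (s τ ω, a τ ω)) t (s t ω, a t ω) = 0).card
        + H * (2 * √L * (2 * √(Fintype.card (S × A) * T))) := by
  have htriv : ∀ t, ∑ s', (M.trans (ϑ t ω) (s t ω) (a t ω) s'
        - M.trans (θ ω) (s t ω) (a t ω) s') * v s' (ϑ t ω) ≤ H := by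
    intro t
    simp only [sub_mul, Finset.sum_sub_distrib]
    have h1 := ParamMDP.sum_trans_mul_le (M := M) (θ := ϑ t ω) (s := s t ω) (a := a t ω)
      (hv_le (ϑ t ω))
    have h2 := ParamMDP.le_sum_trans_mul (M := M) (θ := θ ω) (s := s t ω) (a := a t ω)
      (hv_nonneg (ϑ t ω))
    linarith
  by_cases hbad : ∃ u ∈ Finset.Icc 1 T, IsStageStart (fun τ => (s τ ω, a τ ω)) u ∧
      (Implausible M s a L u (ϑ u ω) ω ∨ Implausible M s a L u (θ ω) ω)
  · obtain ⟨u, hu, hstart, h⟩ := hbad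
    have h1 := one_le_implausibleCount hu hstart h
    have h2 := Finset.sum_le_sum fun t (_ : t ∈ Finset.Icc 1 T) => htriv t
    rw [Finset.sum_const, Nat.card_Icc, Nat.add_sub_cancel, nsmul_eq_mul] at h2
    have h3 : H * T * 1 ≤ H * T * implausibleCount M θ s a ϑ L T ω := by gcongr
    have h4 : 0 ≤ H * ((Finset.Icc 1 T).filter fun t =>
          visits (fun τ => (s τ ω, a τ ω)) t (s t ω, a t ω) = 0).card := by positivity
    have h5 : 0 ≤ H * (2 * √L * (2 * √(Fintype.card (S × A) * T))) := by positivity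
    linarith
  · push Not at hbad
    have hterm : ∀ t ∈ Finset.Icc 1 T, ∑ s', (M.trans (ϑ t ω) (s t ω) (a t ω) s'
        - M.trans (θ ω) (s t ω) (a t ω) s') * v s' (ϑ t ω)
        ≤ H * (if visits (fun τ => (s τ ω, a τ ω)) t (s t ω, a t ω) = 0 then 1 else 0)
          + H * (2 * √L * (1 / √(visits (fun τ => (s τ ω, a τ ω)) t (s t ω, a t ω) : ℝ))) := by
      intro t ht
      obtain ⟨ht1, htT⟩ := Finset.mem_Icc.1 ht
      split_ifs with hnew
      · have h5 : 0 ≤ H * (2 * √L *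
          (1 / √(visits (fun τ => (s τ ω, a τ ω)) t (s t ω, a t ω) : ℝ))) := by positivity
        linarith [htriv t]
      · obtain ⟨u, hu1, hut, hstart, hvis, hconst⟩ :=
          exists_current_start (fun τ => (s τ ω, a τ ω)) ht1
        have hϑ : ϑ t ω = ϑ u ω := hconst (fun t => ϑ t ω) hkeep
        obtain ⟨b1, b2⟩ := hbad u (Finset.mem_Icc.2 ⟨hu1, hut.trans htT⟩) hstart
        rw [← hϑ] at b1
        have := sum_trans_sub_mul_le_of_plausible (p := (s t ω, a t ω)) b1 b2
          (hv_nonneg (ϑ t ω)) (hv_le (ϑ t ω)) hL (Nat.pos_of_ne_zero hnew) (hvis _)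
        simpa using this
    refine (Finset.sum_le_sum hterm).trans ?_
    rw [Finset.sum_add_distrib, ← Finset.mul_sum, ← Finset.mul_sum, ← Finset.mul_sum,
      Finset.sum_boole]
    have h1 := sum_inv_sqrt_visits_le (fun τ => (s τ ω, a τ ω)) T
    have h2 : 0 ≤ H * T * implausibleCount M θ s a ϑ L T ω :=
      mul_nonneg (by positivity) implausibleCount_nonneg
    have h3 : H * (2 * √L * ∑ t ∈ Finset.Icc 1 T,
        1 / √(visits (fun τ => (s τ ω, a τ ω)) t (s t ω, a t ω) : ℝ))
        ≤ H * (2 * √L * (2 * √(Fintype.card (S × A) * T))) := by gcongr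
    linarith

/-- Regret along one path: terms of expectation zero, and terms that are small. -/
lemma sum_regret_le (hv : M.IsValueFunction J v) (hv_nonneg : ∀ θ s, 0 ≤ v s θ)
    (hv_le : ∀ θ s, v s θ ≤ H) (hH : 0 ≤ H) (hL : 0 ≤ L) (hπ : M.IsOptimalPolicy v πopt)
    (hact : ∀ t, 1 ≤ t → a t ω = πopt (s t ω) (ϑ t ω))
    (hkeep : ∀ t, 1 ≤ t → ¬ IsStageStart (fun τ => (s τ ω, a τ ω)) (t + 1) →
      ϑ (t + 1) ω = ϑ t ω)
    (hrew : ∀ u, 1 ≤ u → IsStageStart (fun τ => (s τ ω, a τ ω)) u →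
      ∀ p : S × A, visits (fun τ => (s τ ω, a τ ω)) u p ≠ 0 →
        M.reward (ϑ u ω) p.1 p.2 = M.reward (θ ω) p.1 p.2)
    (hT : 1 ≤ T) (hn : Fintype.card (S × A) ≤ T) :
    ∑ t ∈ Finset.Icc 1 T, (J (θ ω) - M.reward (θ ω) (s t ω) (a t ω))
      ≤ ∑ u ∈ Finset.Icc 1 T, maxLength (fun τ => (s τ ω, a τ ω)) u * (J (θ ω) - J (ϑ u ω))
        + ∑ t ∈ Finset.Icc 1 T, valueNoise M v θ s a (ϑ t) t ω
        + H * T * implausibleCount M θ s a ϑ L T ω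
        + (2 * √(Fintype.card (S × A) * T)
          + H * (3 * √((Fintype.card (S × A) * Nat.log 2 T + 2 : ℕ) * (2 * (T + 1))) + 1
            + Fintype.card (S × A) + 2 * √L * (2 * √(Fintype.card (S × A) * T)))) := by
  classical
  have : Nonempty S := ⟨s 0 ω⟩
  set x : ℕ → S × A := fun τ => (s τ ω, a τ ω) with hx
  obtain ⟨K, hK1, -, hKT, hTK⟩ := exists_last_stage x hT
  have hKle : (K : ℝ) ≤ √((Fintype.card (S × A) * Nat.log 2 T + 2 : ℕ) * (2 * (T + 1))) :=
    Real.le_sqrt_of_sq_le (sq_card_stages_le hK1 hKT hTK)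
  have hJ := fun ϑ' => hv.mem_Icc hπ ϑ'
  have hbell : ∀ t, 1 ≤ t → M.reward (ϑ t ω) (s t ω) (a t ω)
      + ∑ s', M.trans (ϑ t ω) (s t ω) (a t ω) s' * v s' (ϑ t ω)
        = J (ϑ t ω) + v (s t ω) (ϑ t ω) := by
    intro t ht
    rw [hact t ht]
    exact hv.bellmanValue_opt hπ (ϑ t ω) (s t ω)
  have h1 := sum_sub_add_card_new_le (x := x) (j := fun t => J (ϑ t ω)) (c := J (θ ω))
    (b := 2 * H) (by positivity) hn hT
    (fun t ht hs => by simp only [hkeep t ht hs])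
    (fun t _ => by linarith [(hJ (ϑ t ω)).2, (hJ (θ ω)).1])
    -- With equal rewards in both models, the Bellman equality for `ϑ u` and the Bellman inequality
    -- for `θ` differ by at most `H` in the mean next value and `H` in the current value.
    (fun u hu _ hstart hvis => by
      have e1 := hbell u hu
      have e2 := hv.bellmanValue_le (θ ω) (s u ω) (a u ω)
      rw [ParamMDP.bellmanValue] at e2
      have e3 := hrew u hu hstart (s u ω, a u ω) hvis
      simp only at e3
      have e4 := ParamMDP.sum_trans_mul_le (M := M) (θ := ϑ u ω) (s := s u ω) (a := a u ω)
        (hv_le (ϑ u ω))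
      have e5 := ParamMDP.le_sum_trans_mul (M := M) (θ := θ ω) (s := s u ω) (a := a u ω)
        (hv_nonneg (θ ω))
      have e6 := hv_nonneg (ϑ u ω) (s u ω)
      have e7 := hv_le (θ ω) (s u ω)
      linarith) hKT hTK
  have h2 := sum_reward_sub_le (M := M) (θ := θ) (T := T) hkeep hrew
  have h3 := sum_trans_sub_le (M := M) (θ := θ) (T := T) hv_nonneg hv_le hH hL hkeep
  have h4 := sum_value_sub_le hv_nonneg hv_le hH hkeep hTK
  have hdecomp : ∑ t ∈ Finset.Icc 1 T, (J (θ ω) - M.reward (θ ω) (s t ω) (a t ω))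
      = ∑ t ∈ Finset.Icc 1 T, (J (θ ω) - J (ϑ t ω))
        + ∑ t ∈ Finset.Icc 1 T,
          (M.reward (ϑ t ω) (s t ω) (a t ω) - M.reward (θ ω) (s t ω) (a t ω))
        + ∑ t ∈ Finset.Icc 1 T, ∑ s', (M.trans (ϑ t ω) (s t ω) (a t ω) s'
          - M.trans (θ ω) (s t ω) (a t ω) s') * v s' (ϑ t ω)
        + ∑ t ∈ Finset.Icc 1 T, valueNoise M v θ s a (ϑ t) t ω
        + ∑ t ∈ Finset.Icc 1 T, (v (s (t + 1) ω) (ϑ t ω) - v (s t ω) (ϑ t ω)) := by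
    simp only [← Finset.sum_add_distrib]
    refine Finset.sum_congr rfl fun t ht => ?_
    have := hbell t (Finset.mem_Icc.1 ht).1
    simp only [valueNoise, sub_mul, Finset.sum_sub_distrib]
    linarith
  have h5 : H * (((Finset.Icc 1 T).filter fun t => visits x t (s t ω, a t ω) = 0).card : ℝ)
      ≤ H * Fintype.card (S × A) :=
    mul_le_mul_of_nonneg_left (by exact_mod_cast card_new_le x T) hH
  -- The number of stages enters three times: `2 * H * K` from the replaced lengths and `H * K` from
  -- the changes of value function.
  have h6 := mul_le_mul_of_nonneg_left hKle hH
  rw [hdecomp]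
  linarith

end Pathwise

lemma maxLength_abs_le {X : Type*} (x : ℕ → X) (u : ℕ) : |maxLength x u| ≤ u * (u + 1) := by
  refine (Finset.abs_sum_le_sum_abs _ _).trans ?_
  calc _ ≤ ∑ k ∈ Finset.range u, ((u : ℝ) + 1) := by
        refine Finset.sum_le_sum fun k _ => ?_
        split_ifs with h
        · have h1 : (stageStart x k : ℝ) ≤ u := by
            rw [← h]
            exact_mod_cast (stageStart_lt_succ x k).le
          have h2 : (0 : ℝ) ≤ stageStart x k := Nat.cast_nonneg _
          rw [abs_of_nonneg (by linarith)]
          linarith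
        · simp only [abs_zero]
          positivity
    _ = _ := by rw [Finset.sum_const, Finset.card_range, nsmul_eq_mul]

/-! ### Taking expectations -/

section

variable {S A Θ Ω : Type*} [Fintype S] [MeasurableSpace Θ] {θ : Ω → Θ} {s : ℕ → Ω → S}
  {a : ℕ → Ω → A}

lemma regret_eq [MeasurableSpace Ω] (M : ParamMDP S A Θ) (J : Θ → ℝ) (P : Measure Ω)
    (T : ℕ) : regret M J P θ s a T
    = ∫ ω, ∑ t ∈ Finset.Icc 1 T, (J (θ ω) - M.reward (θ ω) (s t ω) (a t ω)) ∂P := by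
  simp [regret, Finset.sum_sub_distrib]

/-- There is nothing to choose, and `J` is the only reward. This case is treated apart because the
numerical estimates for moderate horizons need `S * A ≥ 2`. -/
lemma regret_eq_zero [MeasurableSpace Ω] [Subsingleton S] [Subsingleton A] {M : ParamMDP S A Θ}
    {J : Θ → ℝ} {v : S → Θ → ℝ} {πopt : S → Θ → A} (P : Measure Ω) (hv : M.IsValueFunction J v)
    (hπ : M.IsOptimalPolicy v πopt) (T : ℕ) :
    regret M J P θ s a T = 0 := by
  rw [regret_eq, ← integral_zero Ω ℝ (μ := P)]
  congr 1
  funext ω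
  refine Finset.sum_eq_zero fun t _ => ?_
  have h := hv.bellmanValue_opt hπ (θ ω) (s t ω)
  rw [ParamMDP.bellmanValue, Subsingleton.elim (πopt (s t ω) (θ ω)) (a t ω)] at h
  have hconst : ∀ s', v s' (θ ω) = v (s t ω) (θ ω) := fun s' => by
    rw [Subsingleton.elim s' (s t ω)]
  have h1 := ParamMDP.sum_trans_mul_le (M := M) (θ := θ ω) (s := s t ω) (a := a t ω)
    fun s' => (hconst s').le
  have h2 := ParamMDP.le_sum_trans_mul (M := M) (θ := θ ω) (s := s t ω) (a := a t ω)
    fun s' => (hconst s').ge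
  linarith

variable [MeasurableSpace S] [MeasurableSpace A] {M : ParamMDP S A Θ}

lemma measurable_maxLength [Countable A] [MeasurableSingletonClass S]
    [MeasurableSingletonClass A] (u : ℕ) : Measurable[observed M θ s a u]
    fun ω => maxLength (fun τ => (s τ ω, a τ ω)) u :=
  measurable_observed_of_congr (F := fun x => maxLength x u) fun _ _ h => maxLength_congr h

variable [MeasurableSpace Ω] {μ₁ : Measure Θ} {πopt : S → Θ → A} {P : Measure Ω}
  [IsProbabilityMeasure P] {ϑ : ℕ → Ω → Θ} {J : Θ → ℝ}

namespace IsRun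

lemma integrable_param_comp (hrun : IsRun M μ₁ πopt P θ s a ϑ) (hJm : Measurable J)
    (hJ : ∀ θ, J θ ∈ Set.Icc (0 : ℝ) 1) : Integrable (fun ω => J (θ ω)) P :=
  Integrable.of_mem_Icc 0 1 (hJm.comp hrun.measurable_param).aemeasurable
    (Eventually.of_forall fun _ => hJ _)

lemma nonempty_state (_hrun : IsRun M μ₁ πopt P θ s a ϑ) : Nonempty S :=
  (nonempty_of_isProbabilityMeasure P).map (s 0)

lemma nonempty_action (_hrun : IsRun M μ₁ πopt P θ s a ϑ) : Nonempty A :=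
  (nonempty_of_isProbabilityMeasure P).map (a 0)

lemma bound_nonneg (hrun : IsRun M μ₁ πopt P θ s a ϑ) {v : S → Θ → ℝ} {H : ℝ}
    (hv_nonneg : ∀ θ s, 0 ≤ v s θ) (hv_le : ∀ θ s, v s θ ≤ H) : 0 ≤ H := by
  obtain ⟨ω⟩ := nonempty_of_isProbabilityMeasure P
  obtain ⟨s₀⟩ := hrun.nonempty_state
  exact (hv_nonneg (θ ω) s₀).trans (hv_le (θ ω) s₀)

end IsRun

end

namespace IsRun

variable {S A Θ Ω : Type*} [Fintype S] [Fintype A] [MeasurableSpace Θ]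
  [MeasurableSpace S] [MeasurableSingletonClass S] [MeasurableSpace A] [MeasurableSingletonClass A]
  [MeasurableSpace Ω] {M : ParamMDP S A Θ} {μ₁ : Measure Θ} {πopt : S → Θ → A} {P : Measure Ω}
  [IsProbabilityMeasure P]
  {θ : Ω → Θ} {s : ℕ → Ω → S} {a : ℕ → Ω → A} {ϑ : ℕ → Ω → Θ} {t u T : ℕ}
  {J : Θ → ℝ} {v : S → Θ → ℝ} {H L : ℝ}

lemma integrable_valueNoise (hrun : IsRun M μ₁ πopt P θ s a ϑ) (hv_meas : ∀ s, Measurable (v s))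
    (hv_nonneg : ∀ θ s, 0 ≤ v s θ) (hv_le : ∀ θ s, v s θ ≤ H) {g : Ω → Θ} (hg : Measurable g)
    (t : ℕ) :
    Integrable (fun ω => ∑ s', M.trans (θ ω) (s t ω) (a t ω) s' * v s' (g ω)) P ∧
      Integrable (fun ω => v (s (t + 1) ω) (g ω)) P := by
  have hb : ∀ {f : Ω → ℝ}, Measurable f → (∀ ω, 0 ≤ f ω) → (∀ ω, f ω ≤ H) → Integrable f P :=
    fun hf h0 h1 => Integrable.of_mem_Icc 0 H hf.aemeasurable
      (Eventually.of_forall fun ω => ⟨h0 ω, h1 ω⟩)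
  refine ⟨hb ?_ (fun ω => ParamMDP.le_sum_trans_mul (hv_nonneg (g ω)))
      fun ω => ParamMDP.sum_trans_mul_le (hv_le (g ω)),
    hb ?_ (fun ω => hv_nonneg _ _) fun ω => hv_le _ _⟩
  · refine Finset.measurable_sum _ fun s' _ => Measurable.mul ?_ ((hv_meas s').comp hg)
    exact measurable_apply_of_countable (f := fun (p : S × A) ϑ => M.trans ϑ p.1 p.2 s')
      (fun p => M.measurable_trans p.1 p.2 s')
      ((hrun.measurable_state t).prodMk (hrun.measurable_action t)) hrun.measurable_param
  · exact measurable_apply_of_countable hv_meas (hrun.measurable_state (t + 1)) hg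

/-- The parameter `g` only has to be determined before the transition: the sample is used for the
upper bound on the regret, the truth for the lower bound. -/
lemma integral_valueNoise (hrun : IsRun M μ₁ πopt P θ s a ϑ) (hv_meas : ∀ s, Measurable (v s))
    (hv_nonneg : ∀ θ s, 0 ≤ v s θ) (hv_le : ∀ θ s, v s θ ≤ H) (ht : 1 ≤ t) {g : Ω → Θ}
    (hg : Measurable[beforeTransition M θ s a ϑ t] g) :
    ∫ ω, valueNoise M v θ s a g t ω ∂P = 0 := by
  obtain ⟨h1, h2⟩ := hrun.integrable_valueNoise hv_meas hv_nonneg hv_le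
    (hg.mono (hrun.beforeTransition_le t) le_rfl) t
  unfold valueNoise
  rw [integral_sub h1 h2, hrun.integral_next_state ht (f := fun s' ω => v s' (g ω))
    (fun s' => (hv_meas s').comp hg)
    (fun s' ω => (abs_of_nonneg (hv_nonneg _ _)).trans_le (hv_le _ _)), sub_self]

lemma integrable_maxLength_mul (hrun : IsRun M μ₁ πopt P θ s a ϑ) (hJm : Measurable J)
    (hJ : ∀ θ, J θ ∈ Set.Icc (0 : ℝ) 1) {g : Ω → Θ} (hg : Measurable g) (u : ℕ) :
    Integrable (fun ω => maxLength (fun τ => (s τ ω, a τ ω)) u * J (g ω)) P := by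
  have hm : Measurable fun ω => maxLength (fun τ => (s τ ω, a τ ω)) u :=
    (measurable_maxLength (M := M) (θ := θ) u).mono (hrun.observed_le u) le_rfl
  refine Integrable.of_bound (hm.mul (hJm.comp hg)).aestronglyMeasurable (u * (u + 1))
    (Eventually.of_forall fun ω => ?_)
  rw [norm_mul, Real.norm_eq_abs, Real.norm_eq_abs, abs_of_nonneg (hJ _).1]
  exact (mul_le_of_le_one_right (abs_nonneg _) (hJ _).2).trans (maxLength_abs_le _ u)

/-- The weight is a function of the history and vanishes when no stage starts in round `u`, so
posterior sampling exchanges `ϑ u` and `θ`. -/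
lemma integral_maxLength_mul (hrun : IsRun M μ₁ πopt P θ s a ϑ) (hJm : Measurable J)
    (hJ : ∀ θ, J θ ∈ Set.Icc (0 : ℝ) 1) (hu : 1 ≤ u) :
    ∫ ω, maxLength (fun τ => (s τ ω, a τ ω)) u * (J (θ ω) - J (ϑ u ω)) ∂P = 0 := by
  have h1 := hrun.integrable_maxLength_mul hJm hJ hrun.measurable_param u
  have h2 := hrun.integrable_maxLength_mul hJm hJ (hrun.measurable_sample u) u
  simp only [mul_sub]
  rw [integral_sub h1 h2, hrun.integral_sample_eq hu (measurable_maxLength u)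
    (f := fun z => z.1 * J z.2) (by fun_prop), sub_self]
  intro ω hω
  simp [maxLength_eq_zero hω]

/-- By posterior sampling the terms for the sampled parameters have the same expectation as those
for the truth, which concentration bounds; hence the factor `2`. -/
lemma integral_implausibleCount_le (hrun : IsRun M μ₁ πopt P θ s a ϑ) (hL : 0 ≤ L) :
    Integrable (implausibleCount M θ s a ϑ L T) P ∧
    ∫ ω, implausibleCount M θ s a ϑ L T ω ∂P
      ≤ 2 * T * (Fintype.card S * Fintype.card A * 2 ^ Fintype.card S * T * Real.exp (-L)) := by
  have hset : ∀ {g : Ω → Θ}, Measurable g → ∀ u, MeasurableSet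
      {ω | IsStageStart (fun τ => (s τ ω, a τ ω)) u ∧ Implausible M s a L u (g ω) ω} :=
    fun hg u => (hrun.measurableSet_start u).inter (hrun.measurableSet_implausible L u hg)
  have hint : ∀ {g : Ω → Θ}, Measurable g → ∀ u, Integrable
      ({ω | IsStageStart (fun τ => (s τ ω, a τ ω)) u ∧ Implausible M s a L u (g ω) ω}.indicator
        fun _ => (1 : ℝ)) P := fun hg u => (integrable_const (1 : ℝ)).indicator (hset hg u)
  have hθ := hrun.measurable_param
  have hϑ := hrun.measurable_sample
  unfold implausibleCount
  have hadd : ∀ u ∈ Finset.Icc 1 T, Integrable (fun ω =>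
      {ω | IsStageStart (fun τ => (s τ ω, a τ ω)) u ∧
        Implausible M s a L u (ϑ u ω) ω}.indicator (fun _ => (1 : ℝ)) ω
      + {ω | IsStageStart (fun τ => (s τ ω, a τ ω)) u ∧
        Implausible M s a L u (θ ω) ω}.indicator (fun _ => (1 : ℝ)) ω) P :=
    fun u _ => (hint (hϑ u) u).add (hint hθ u)
  refine ⟨integrable_finsetSum _ hadd, ?_⟩
  rw [integral_finsetSum _ hadd]
  calc _ ≤ ∑ u ∈ Finset.Icc 1 T,
        2 * (Fintype.card S * Fintype.card A * 2 ^ Fintype.card S * T * Real.exp (-L)) := by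
        refine Finset.sum_le_sum fun u hu => ?_
        obtain ⟨hu1, huT⟩ := Finset.mem_Icc.1 hu
        rw [integral_add (hint (hϑ u) u) (hint hθ u), integral_indicator_const _ (hset (hϑ u) u),
          integral_indicator_const _ (hset hθ u), smul_eq_mul, mul_one, smul_eq_mul, mul_one,
          measureReal_def, hrun.measure_implausible_sample L hu1, ← measureReal_def, ← two_mul]
        gcongr
        refine (measureReal_mono (fun ω hω => hω.2) (measure_ne_top _ _)).trans
          ((hrun.measure_implausible_le hL hu1).trans ?_)
        gcongr
    _ = _ := by
        rw [Finset.sum_const, Nat.card_Icc, Nat.add_sub_cancel, nsmul_eq_mul]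
        ring

lemma integrable_reward (hrun : IsRun M μ₁ πopt P θ s a ϑ) (t : ℕ) :
    Integrable (fun ω => M.reward (θ ω) (s t ω) (a t ω)) P :=
  Integrable.of_mem_Icc 0 1 (hrun.measurable_reward_comp hrun.measurable_param t).aemeasurable
    (Eventually.of_forall fun _ => M.reward_mem _ _ _)

lemma regret_le (hrun : IsRun M μ₁ πopt P θ s a ϑ) (hv : M.IsValueFunction J v)
    (hv_meas : ∀ s, Measurable (v s)) (hv_nonneg : ∀ θ s, 0 ≤ v s θ)
    (hv_le : ∀ θ s, v s θ ≤ H) (hπ_meas : ∀ s, Measurable (πopt s))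
    (hπ : M.IsOptimalPolicy v πopt) (hL : 0 ≤ L) (hT : 1 ≤ T)
    (hn : Fintype.card (S × A) ≤ T) :
    regret M J P θ s a T ≤ H * T * (2 * T * (Fintype.card S * Fintype.card A
        * 2 ^ Fintype.card S * T * Real.exp (-L)))
      + (2 * √(Fintype.card (S × A) * T)
        + H * (3 * √((Fintype.card (S × A) * Nat.log 2 T + 2 : ℕ) * (2 * (T + 1))) + 1
          + Fintype.card (S × A) + 2 * √L * (2 * √(Fintype.card (S × A) * T)))) := by
  have hH := hrun.bound_nonneg hv_nonneg hv_le
  have := hrun.nonempty_state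
  have hJ := fun ϑ' => hv.mem_Icc hπ ϑ'
  have hJm : Measurable J := hv.measurable hv_meas hπ_meas hπ
  have hθ := hrun.measurable_param
  have hϑ := hrun.measurable_sample
  obtain ⟨hcount, hcount_le⟩ := hrun.integral_implausibleCount_le (T := T) hL
  have hml : ∀ u ∈ Finset.Icc 1 T, Integrable (fun ω =>
      maxLength (fun τ => (s τ ω, a τ ω)) u * (J (θ ω) - J (ϑ u ω))) P := by
    intro u _
    simp only [mul_sub]
    exact (hrun.integrable_maxLength_mul hJm hJ hθ u).sub
      (hrun.integrable_maxLength_mul hJm hJ (hϑ u) u)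
  have hvn : ∀ t ∈ Finset.Icc 1 T, Integrable (valueNoise M v θ s a (ϑ t) t) P := by
    intro t _
    obtain ⟨h1, h2⟩ := hrun.integrable_valueNoise hv_meas hv_nonneg hv_le (hϑ t) t
    exact h1.sub h2
  rw [regret_eq]
  set C : ℝ := 2 * √(Fintype.card (S × A) * T)
        + H * (3 * √((Fintype.card (S × A) * Nat.log 2 T + 2 : ℕ) * (2 * (T + 1))) + 1
          + Fintype.card (S × A) + 2 * √L * (2 * √(Fintype.card (S × A) * T)))
  have hi1 := integrable_finsetSum _ hml
  have hi2 := integrable_finsetSum _ hvn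
  have hi3 := hcount.const_mul (H * T)
  have hi12 : Integrable (fun ω => ∑ u ∈ Finset.Icc 1 T,
      maxLength (fun τ => (s τ ω, a τ ω)) u * (J (θ ω) - J (ϑ u ω))
        + ∑ t ∈ Finset.Icc 1 T, valueNoise M v θ s a (ϑ t) t ω) P := hi1.add hi2
  have hi123 : Integrable (fun ω => ∑ u ∈ Finset.Icc 1 T,
      maxLength (fun τ => (s τ ω, a τ ω)) u * (J (θ ω) - J (ϑ u ω))
        + ∑ t ∈ Finset.Icc 1 T, valueNoise M v θ s a (ϑ t) t ω
        + H * T * implausibleCount M θ s a ϑ L T ω) P := hi12.add hi3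
  calc _ ≤ ∫ ω, (∑ u ∈ Finset.Icc 1 T,
          maxLength (fun τ => (s τ ω, a τ ω)) u * (J (θ ω) - J (ϑ u ω))
        + ∑ t ∈ Finset.Icc 1 T, valueNoise M v θ s a (ϑ t) t ω
        + H * T * implausibleCount M θ s a ϑ L T ω + C) ∂P := by
        refine integral_mono_ae ?_ (hi123.add (integrable_const C)) ?_
        · exact integrable_finsetSum _ fun t _ =>
            (hrun.integrable_param_comp hJm hJ).sub (hrun.integrable_reward t)
        · filter_upwards [hrun.ae_reward_eq] with ω hω
          exact sum_regret_le hv hv_nonneg hv_le hH hL hπ (fun t ht => hrun.action_eq t ht ω)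
            (fun t ht => hrun.sample_keep t ht ω) hω hT hn
    _ = H * T * ∫ ω, implausibleCount M θ s a ϑ L T ω ∂P + C := by
        rw [integral_add hi123 (integrable_const C),
          integral_add hi12 hi3, integral_add hi1 hi2, integral_finsetSum _ hml,
          integral_finsetSum _ hvn, integral_const_mul,
          Finset.sum_eq_zero fun u hu =>
            hrun.integral_maxLength_mul hJm hJ (Finset.mem_Icc.1 hu).1,
          Finset.sum_eq_zero fun t ht => hrun.integral_valueNoise hv_meas hv_nonneg hv_le
            (Finset.mem_Icc.1 ht).1 measurable_sample_beforeTransition]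
        simp
    _ ≤ _ := by gcongr

/-- No policy earns much more than the optimal average reward. -/
lemma neg_le_regret (hrun : IsRun M μ₁ πopt P θ s a ϑ) (hv : M.IsValueFunction J v)
    (hv_meas : ∀ s, Measurable (v s)) (hv_nonneg : ∀ θ s, 0 ≤ v s θ)
    (hv_le : ∀ θ s, v s θ ≤ H) (hπ_meas : ∀ s, Measurable (πopt s))
    (hπ : M.IsOptimalPolicy v πopt) (T : ℕ) : -H ≤ regret M J P θ s a T := by
  have := hrun.nonempty_state
  have hJ := fun ϑ' => hv.mem_Icc hπ ϑ'
  have hJm : Measurable J := hv.measurable hv_meas hπ_meas hπ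
  have hvn : ∀ t ∈ Finset.Icc 1 T, Integrable (valueNoise M v θ s a θ t) P := by
    intro t _
    obtain ⟨h1, h2⟩ := hrun.integrable_valueNoise hv_meas hv_nonneg hv_le
      hrun.measurable_param t
    exact h1.sub h2
  have hi := integrable_finsetSum _ hvn
  rw [regret_eq]
  calc -H = ∫ ω, (∑ t ∈ Finset.Icc 1 T, valueNoise M v θ s a θ t ω + -H) ∂P := by
        rw [integral_add hi (integrable_const _), integral_finsetSum _ hvn,
          Finset.sum_eq_zero fun t ht => hrun.integral_valueNoise hv_meas hv_nonneg hv_le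
            (Finset.mem_Icc.1 ht).1 measurable_param_beforeTransition]
        simp
    _ ≤ _ := by
        refine integral_mono (hi.add (integrable_const _)) (integrable_finsetSum _ fun t _ =>
            (hrun.integrable_param_comp hJm hJ).sub (hrun.integrable_reward t)) fun ω => ?_
        -- The Bellman inequality for the true model holds for any action; the noise has mean zero
        -- and the value increments telescope to at least `-H`.
        have hterm : ∀ t ∈ Finset.Icc 1 T, valueNoise M v θ s a θ t ω
            + (v (s (t + 1) ω) (θ ω) - v (s t ω) (θ ω))
              ≤ J (θ ω) - M.reward (θ ω) (s t ω) (a t ω) := by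
          intro t _
          have := hv.bellmanValue_le (θ ω) (s t ω) (a t ω)
          rw [ParamMDP.bellmanValue] at this
          rw [valueNoise]
          linarith
        refine le_trans ?_ (Finset.sum_le_sum hterm)
        rw [Finset.sum_add_distrib]
        gcongr
        rw [← Finset.Ico_add_one_right_eq_Icc,
          Finset.sum_Ico_sub (fun t => v (s t ω) (θ ω)) (by omega)]
        linarith [hv_nonneg (θ ω) (s (T + 1) ω), hv_le (θ ω) (s 1 ω)]

lemma regret_le_self (hrun : IsRun M μ₁ πopt P θ s a ϑ) (hv : M.IsValueFunction J v)
    (hv_meas : ∀ s, Measurable (v s)) (hπ_meas : ∀ s, Measurable (πopt s))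
    (hπ : M.IsOptimalPolicy v πopt) (T : ℕ) : regret M J P θ s a T ≤ T := by
  have := hrun.nonempty_state
  have hJ := fun ϑ' => hv.mem_Icc hπ ϑ'
  have hJm : Measurable J := hv.measurable hv_meas hπ_meas hπ
  rw [regret_eq]
  calc _ ≤ ∫ ω, (T : ℝ) ∂P := by
        refine integral_mono (integrable_finsetSum _ fun t _ =>
            (hrun.integrable_param_comp hJm hJ).sub (hrun.integrable_reward t))
          (integrable_const _) fun ω => ?_
        calc _ ≤ ∑ t ∈ Finset.Icc 1 T, (1 : ℝ) := Finset.sum_le_sum fun t _ => by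
              linarith [(hJ (θ ω)).2, (M.reward_mem (θ ω) (s t ω) (a t ω)).1]
          _ = T := by simp
    _ = T := by simp

end IsRun

/-! ### Numerical estimates and the growth of the bound -/

lemma le_four_mul_log {T : ℕ} (h2 : 2 ≤ T) (h8 : T ≤ 8) : (T : ℝ) ≤ 4 * Real.log T := by
  have hT : (0 : ℝ) < T := by positivity
  rw [show 4 * Real.log T = Real.log ((T : ℝ) ^ 4) by rw [Real.log_pow]; norm_num,
    Real.le_log_iff_exp_le (by positivity), ← mul_one (T : ℝ), Real.exp_nat_mul, mul_one]
  refine (pow_le_pow_left₀ (Real.exp_pos 1).le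
    (Real.exp_one_lt_d9.le.trans (by norm_num : (2.7182818286 : ℝ) ≤ 2.72)) T).trans ?_
  interval_cases T <;> norm_num

lemma two_le_log {T : ℕ} (hT : 9 ≤ T) : 2 ≤ Real.log T := by
  rw [Real.le_log_iff_exp_le (by positivity), show (2 : ℝ) = (2 : ℕ) * 1 by norm_num,
    Real.exp_nat_mul]
  have h9 : (9 : ℝ) ≤ T := by exact_mod_cast hT
  nlinarith [Real.exp_one_lt_d9, Real.exp_pos 1]

/-- The exponential is `(A T) ^ (-6 S)`. Half of the exponent absorbs `2 S 2 ^ S ≤ 2 ^ (3 S)`, the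
other half `A T ^ 3`. Failure of the confidence sets thus costs at most `H` in all. -/
lemma two_mul_card_mul_exp_le {S A T : ℕ} (hS : 1 ≤ S) (hA : 1 ≤ A) (hT : 2 ≤ T) :
    2 * (T : ℝ) * T * (S * A * 2 ^ S * T * Real.exp (-(6 * S * Real.log (A * T)))) ≤ 1 := by
  have hnat : 2 * T * T * (S * A * 2 ^ S * T) ≤ (A * T) ^ (6 * S) := by
    have hy : 2 ≤ A * T := by nlinarith
    have h1 : A * T ^ 3 ≤ (A * T) ^ (3 * S) := by
      calc A * T ^ 3 ≤ A ^ 3 * T ^ 3 := by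
            gcongr
            exact Nat.le_self_pow (by norm_num) A
        _ = (A * T) ^ 3 := (mul_pow _ _ _).symm
        _ ≤ _ := Nat.pow_le_pow_right (by omega) (by omega)
    have h2 : 2 * S * 2 ^ S ≤ (A * T) ^ (3 * S) := by
      have h3 : 2 * S ≤ 2 ^ (2 * S) := Nat.lt_two_pow_self.le
      calc 2 * S * 2 ^ S ≤ 2 ^ (2 * S) * 2 ^ S := by gcongr
        _ = 2 ^ (3 * S) := by rw [← pow_add]; congr 1; ring
        _ ≤ _ := Nat.pow_le_pow_left hy _
    calc 2 * T * T * (S * A * 2 ^ S * T) = (2 * S * 2 ^ S) * (A * T ^ 3) := by ring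
      _ ≤ (A * T) ^ (3 * S) * (A * T) ^ (3 * S) := Nat.mul_le_mul h2 h1
      _ = _ := by rw [← pow_add]; congr 1; ring
  have hAT : (0 : ℝ) < A * T := by
    have : (0 : ℝ) < A := by exact_mod_cast hA
    have : (0 : ℝ) < T := by positivity
    positivity
  have hexp : Real.exp (6 * S * Real.log (A * T)) = ((A : ℝ) * T) ^ (6 * S) := by
    rw [show 6 * (S : ℝ) * Real.log (A * T) = (6 * S : ℕ) * Real.log (A * T) by push_cast; ring,
      Real.exp_nat_mul, Real.exp_log hAT]
  rw [Real.exp_neg, hexp, ← mul_assoc, ← div_eq_mul_inv, div_le_one (by positivity)]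
  exact_mod_cast hnat

lemma regretBound_nonneg (S A : ℕ) {H : ℝ} (hH : 0 ≤ H) (T : ℕ) : 0 ≤ regretBound S A H T := by
  unfold regretBound
  positivity

/-- Short horizons: the bound exceeds the greatest possible regret. -/
lemma le_regretBound_of_le {S A : ℕ} {H : ℝ} (hH : 0 ≤ H) {T : ℕ}
    (h : (T : ℝ) ≤ 2 * S * A * Real.log T) : (T : ℝ) ≤ regretBound S A H T := by
  have h1 : (T : ℝ) ≤ √(2 * S * A * T * Real.log T) := by
    refine Real.le_sqrt_of_sq_le ?_
    nlinarith [mul_le_mul_of_nonneg_left h (Nat.cast_nonneg (α := ℝ) T)]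
  have h2 : 0 ≤ 49 * H * S * √(A * T * Real.log (A * T)) := by positivity
  have h3 : 0 ≤ H * √(2 * S * A * T * Real.log T) := by positivity
  unfold regretBound
  linarith

lemma natLog_two_le {T : ℕ} (hT : 1 ≤ T) : (Nat.log 2 T : ℝ) ≤ 2 * Real.log T := by
  have h1 : (2 : ℝ) ^ Nat.log 2 T ≤ T := by exact_mod_cast Nat.pow_log_le_self 2 (by omega)
  have h2 := Real.log_le_log (by positivity) h1
  rw [Real.log_pow] at h2
  nlinarith [Real.log_two_gt_d9, Nat.cast_nonneg (α := ℝ) (Nat.log 2 T)]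

/-- The term without `H` fits under `√(2SAT log T)` because `log T ≥ 2`. With `X = S √(AT log(AT))`
the others add up to `H X` times `3 * 4 + 1 + 1 + 12 = 26`, and `1` more for the summand `H`, well
below `49`. -/
lemma le_regretBound_of_lt {S A : ℕ} (hS : 1 ≤ S) (hA : 1 ≤ A) {H : ℝ} (hH : 0 ≤ H) {T : ℕ}
    (hT : 1 ≤ T) (hlog : 2 ≤ Real.log T) (hn : S * A ≤ T) :
    H + (2 * √((S * A : ℕ) * T)
        + H * (3 * √((S * A * Nat.log 2 T + 2 : ℕ) * (2 * (T + 1))) + 1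
          + (S * A : ℕ) + 2 * √(6 * S * Real.log (A * T)) * (2 * √((S * A : ℕ) * T))))
      ≤ regretBound S A H T := by
  have hS' : (1 : ℝ) ≤ S := by exact_mod_cast hS
  have hA' : (1 : ℝ) ≤ A := by exact_mod_cast hA
  have hT' : (1 : ℝ) ≤ T := by exact_mod_cast hT
  have hn' : (S : ℝ) * A ≤ T := by exact_mod_cast hn
  have hAT : (1 : ℝ) ≤ A * T := one_le_mul_of_one_le_of_one_le hA' hT'
  have hlog' : Real.log T ≤ Real.log (A * T) :=
    Real.log_le_log (by positivity) (le_mul_of_one_le_left (by positivity) hA')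
  have hX : ∀ c y : ℝ, 0 ≤ c → y ≤ c ^ 2 * (S ^ 2 * (A * T * Real.log (A * T))) →
      √y ≤ c * (S * √(A * T * Real.log (A * T))) := by
    intro c y hc hy
    refine Real.sqrt_le_iff.2 ⟨by positivity, hy.trans_eq ?_⟩
    rw [mul_pow, mul_pow, Real.sq_sqrt]
    exact mul_nonneg (by positivity) (by linarith)
  have hbase : (S : ℝ) * (A * T * Real.log T) ≤ S ^ 2 * (A * T * Real.log (A * T)) := by
    gcongr
    nlinarith
  set X : ℝ := S * √(A * T * Real.log (A * T)) with hXdef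
  have hmain : 2 * √((S * A : ℕ) * T) ≤ √(2 * S * A * T * Real.log T) := by
    rw [show (2 : ℝ) = √4 by rw [show (4 : ℝ) = 2 ^ 2 by norm_num, Real.sqrt_sq (by norm_num)],
      ← Real.sqrt_mul (by norm_num)]
    rw [show √(4 : ℝ) = 2 by rw [show (4 : ℝ) = 2 ^ 2 by norm_num, Real.sqrt_sq (by norm_num)]]
    refine Real.sqrt_le_sqrt ?_
    push_cast
    have : (0 : ℝ) ≤ S * A * T := by positivity
    nlinarith
  have hone : 1 ≤ X := by
    have h := hX 1 1 zero_le_one ?_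
    · rwa [Real.sqrt_one, one_mul] at h
    · rw [one_pow, one_mul]
      exact one_le_mul_of_one_le_of_one_le (one_le_pow₀ hS')
        (one_le_mul_of_one_le_of_one_le hAT (by linarith))
  have hcard : ((S * A : ℕ) : ℝ) ≤ X := by
    rw [← one_mul X, ← Real.sqrt_sq (Nat.cast_nonneg (S * A))]
    refine hX 1 _ zero_le_one ?_
    push_cast
    rw [one_pow, one_mul]
    refine le_trans ?_ hbase
    have h1 : (0 : ℝ) ≤ S * A := by positivity
    nlinarith [mul_le_mul_of_nonneg_left hn' h1]
  have hstages : √((S * A * Nat.log 2 T + 2 : ℕ) * (2 * ((T : ℝ) + 1))) ≤ 4 * X := by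
    refine hX 4 _ (by norm_num) ?_
    have h1 := natLog_two_le hT
    push_cast
    have hSA : (1 : ℝ) ≤ S * A := one_le_mul_of_one_le_of_one_le hS' hA'
    have h2 : (S : ℝ) * A * Nat.log 2 T + 2 ≤ 3 * (S * A * Real.log T) := by nlinarith
    calc _ ≤ 3 * (S * A * Real.log T) * (4 * T) := by
          refine mul_le_mul h2 (by linarith) (by positivity) (by positivity)
      _ = 12 * (S * (A * T * Real.log T)) := by ring
      _ ≤ 4 ^ 2 * (S ^ 2 * (A * T * Real.log (A * T))) := by
          have : (0 : ℝ) ≤ S * (A * T * Real.log T) := by positivity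
          linarith
  have hconf : 2 * √(6 * S * Real.log (A * T)) * (2 * √((S * A : ℕ) * T)) ≤ 12 * X := by
    have h1 : √(6 * S * Real.log (A * T)) * √((S * A : ℕ) * T) ≤ 3 * X := by
      rw [← Real.sqrt_mul (mul_nonneg (by positivity) (by linarith))]
      refine hX 3 _ (by norm_num) ?_
      push_cast
      have : (0 : ℝ) ≤ S ^ 2 * (A * T * Real.log (A * T)) :=
        mul_nonneg (by positivity) (mul_nonneg (by positivity) (by linarith))
      nlinarith
    linarith
  have hfinal : regretBound S A H T = √(2 * S * A * T * Real.log T)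
      + H * √(2 * S * A * T * Real.log T) + 49 * H * X := by
    rw [hXdef]
    unfold regretBound
    ring
  rw [hfinal]
  have h1 : 0 ≤ H * √(2 * S * A * T * Real.log T) := by positivity
  have h2 : H * (3 * √((S * A * Nat.log 2 T + 2 : ℕ) * (2 * ((T : ℝ) + 1))) + 1
          + (S * A : ℕ) + 2 * √(6 * S * Real.log (A * T)) * (2 * √((S * A : ℕ) * T)))
      ≤ H * (26 * X) := by
    gcongr
    linarith
  have h3 : H * 1 ≤ H * X := by gcongr
  have h4 : 0 ≤ H * X := by positivity
  linarith

lemma tendsto_sqrt_mul_log_div (c : ℝ) {d : ℝ} (hd : 0 < d) :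
    Tendsto (fun T : ℕ => √(c * T * Real.log (d * T)) / T) atTop (𝓝 0) := by
  have h1 : Tendsto (fun T : ℕ => Real.log (d * T) / (d * T)) atTop (𝓝 0) :=
    Real.isLittleO_log_id_atTop.tendsto_div_nhds_zero.comp
      (tendsto_natCast_atTop_atTop.const_mul_atTop hd)
  have h2 := ((h1.const_mul (c * d)).sqrt)
  rw [mul_zero, Real.sqrt_zero] at h2
  refine h2.congr' ?_
  filter_upwards [eventually_gt_atTop 0] with T hT
  have hT' : (0 : ℝ) < T := by exact_mod_cast hT
  rw [eq_div_iff hT'.ne', ← Real.sqrt_sq hT'.le, ← Real.sqrt_mul' _ (by positivity),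
    Real.sqrt_sq hT'.le]
  congr 1
  field_simp

lemma tendsto_regretBound_div (S : ℕ) {A : ℕ} (hA : 1 ≤ A) (H : ℝ) :
    Tendsto (fun T : ℕ => regretBound S A H T / (T : ℝ)) atTop (𝓝 0) := by
  have h1 := (tendsto_sqrt_mul_log_div (2 * S * A) one_pos).const_mul (H + 1)
  have h2 := (tendsto_sqrt_mul_log_div A (d := A) (by exact_mod_cast hA)).const_mul (49 * H * S)
  have h := h1.add h2
  simp only [mul_zero, add_zero, one_mul] at h
  refine h.congr fun T => ?_
  unfold regretBound
  ring

end BALSA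

/-! ### The regret bound and its consequences -/

theorem BALSA.IsRun.regret_le_regretBound {S A Θ Ω : Type*} [Fintype S] [Fintype A]
    [MeasurableSpace S] [MeasurableSingletonClass S]
    [MeasurableSpace A] [MeasurableSingletonClass A]
    [MeasurableSpace Θ] [MeasurableSpace Ω]
    {M : ParamMDP S A Θ} {J : Θ → ℝ} {v : S → Θ → ℝ} (hv : M.IsValueFunction J v)
    (hv_meas : ∀ s, Measurable (v s))
    {H : ℝ} (hv_nonneg : ∀ θ s, 0 ≤ v s θ) (hv_le : ∀ θ s, v s θ ≤ H)
    {πopt : S → Θ → A} (hπ_meas : ∀ s, Measurable (πopt s)) (hπ : M.IsOptimalPolicy v πopt)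
    {μ₁ : Measure Θ} {P : Measure Ω} [IsProbabilityMeasure P]
    {θ : Ω → Θ} {s : ℕ → Ω → S} {a : ℕ → Ω → A} {ϑ : ℕ → Ω → Θ}
    (hrun : BALSA.IsRun M μ₁ πopt P θ s a ϑ) {T : ℕ} (hT : 2 ≤ T) :
    BALSA.regret M J P θ s a T
      ≤ BALSA.regretBound (Fintype.card S) (Fintype.card A) H T := by
  have hH := hrun.bound_nonneg hv_nonneg hv_le
  have := hrun.nonempty_state
  have := hrun.nonempty_action
  have hS : 1 ≤ Fintype.card S := Fintype.card_pos
  have hA : 1 ≤ Fintype.card A := Fintype.card_pos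
  -- For short horizons the trivial bound `T` suffices. Otherwise, with at least two pairs, `T > 4
  -- log T`, which rules out `T ≤ 8` and gives `log T ≥ 2` and `S * A ≤ T`.
  rcases le_or_gt (T : ℝ) (2 * Fintype.card S * Fintype.card A * Real.log T) with hshort | hlong
  · exact (hrun.regret_le_self hv hv_meas hπ_meas hπ T).trans
      (BALSA.le_regretBound_of_le hH hshort)
  rcases Nat.lt_or_ge (Fintype.card S * Fintype.card A) 2 with hone | htwo
  · have hS1 : Fintype.card S ≤ 1 := by nlinarith
    have hA1 : Fintype.card A ≤ 1 := by nlinarith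
    have := Fintype.card_le_one_iff_subsingleton.1 hS1
    have := Fintype.card_le_one_iff_subsingleton.1 hA1
    rw [BALSA.regret_eq_zero P hv hπ]
    exact BALSA.regretBound_nonneg _ _ hH T
  have htwo' : (2 : ℝ) ≤ Fintype.card S * Fintype.card A := by exact_mod_cast htwo
  have hT' : (2 : ℝ) ≤ T := by exact_mod_cast hT
  have hlog0 : 0 < Real.log T := Real.log_pos (by linarith)
  have hT9 : 9 ≤ T := by
    by_contra! h
    have := BALSA.le_four_mul_log hT (by omega)
    nlinarith
  have hlog := BALSA.two_le_log hT9
  have hn : Fintype.card S * Fintype.card A ≤ T := by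
    have : (Fintype.card S : ℝ) * Fintype.card A ≤ T := by nlinarith
    exact_mod_cast this
  have hAT : (1 : ℝ) ≤ Fintype.card A * T :=
    one_le_mul_of_one_le_of_one_le (by exact_mod_cast hA) (by linarith)
  have h := hrun.regret_le hv hv_meas hv_nonneg hv_le hπ_meas hπ
    (L := 6 * Fintype.card S * Real.log (Fintype.card A * T))
    (mul_nonneg (by positivity) (Real.log_nonneg hAT)) (by omega : 1 ≤ T)
    (by rwa [Fintype.card_prod])
  rw [Fintype.card_prod] at h
  refine h.trans (le_trans ?_ (BALSA.le_regretBound_of_lt hS hA hH (by omega) hlog hn))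
  gcongr
  have hfail := mul_le_mul_of_nonneg_left (BALSA.two_mul_card_mul_exp_le hS hA hT) hH
  linarith

theorem theorem3 {S A Θ Ω : Type*} [Fintype S] [Fintype A]
    [MeasurableSpace S] [MeasurableSingletonClass S]
    [MeasurableSpace A] [MeasurableSingletonClass A]
    [MeasurableSpace Θ] [MeasurableSpace Ω]
    (M : ParamMDP S A Θ) (J : Θ → ℝ) (v : S → Θ → ℝ) (hv : M.IsValueFunction J v)
    (hv_meas : ∀ s, Measurable (v s))
    (H : ℝ) (hv_nonneg : ∀ θ s, 0 ≤ v s θ) (hv_le : ∀ θ s, v s θ ≤ H)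
    (πopt : S → Θ → A) (hπ_meas : ∀ s, Measurable (πopt s)) (hπ : M.IsOptimalPolicy v πopt)
    (μ₁ : Measure Θ) (P : Measure Ω) [IsProbabilityMeasure P]
    (θ : Ω → Θ) (s : ℕ → Ω → S) (a : ℕ → Ω → A) (ϑ : ℕ → Ω → Θ)
    (hrun : BALSA.IsRun M μ₁ πopt P θ s a ϑ) :
    (∀ T : ℕ, 2 ≤ T →
      BALSA.regret M J P θ s a T
        ≤ BALSA.regretBound (Fintype.card S) (Fintype.card A) H T) ∧
    (fun T : ℕ => BALSA.regretBound (Fintype.card S) (Fintype.card A) H T)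
      =o[atTop] (fun T : ℕ => (T : ℝ)) ∧
    Tendsto (fun T : ℕ => BALSA.regret M J P θ s a T / (T : ℝ)) atTop (𝓝 0) ∧
    Tendsto (fun T : ℕ =>
        (∫ ω, ∑ t ∈ Finset.Icc 1 T, M.reward (θ ω) (s t ω) (a t ω) ∂P) / (T : ℝ))
      atTop (𝓝 (∫ ω, J (θ ω) ∂P)) := by
  have := hrun.nonempty_state
  have := hrun.nonempty_action
  have hbound : ∀ T : ℕ, 2 ≤ T → BALSA.regret M J P θ s a T
      ≤ BALSA.regretBound (Fintype.card S) (Fintype.card A) H T := fun T hT =>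
    hrun.regret_le_regretBound hv hv_meas hv_nonneg hv_le hπ_meas hπ hT
  have hlim := BALSA.tendsto_regretBound_div (Fintype.card S) (A := Fintype.card A)
    Fintype.card_pos H
  have hregret : Tendsto (fun T : ℕ => BALSA.regret M J P θ s a T / (T : ℝ)) atTop (𝓝 0) := by
    have hlow : Tendsto (fun T : ℕ => -H / (T : ℝ)) atTop (𝓝 0) :=
      tendsto_const_nhds.div_atTop tendsto_natCast_atTop_atTop
    refine tendsto_of_tendsto_of_tendsto_of_le_of_le' hlow hlim ?_ ?_
    · refine Eventually.of_forall fun T => ?_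
      have := hrun.neg_le_regret hv hv_meas hv_nonneg hv_le hπ_meas hπ T
      gcongr
    · filter_upwards [eventually_ge_atTop 2] with T hT
      have := hbound T hT
      gcongr
  refine ⟨hbound, ?_, hregret, ?_⟩
  · refine (isLittleO_iff_tendsto' ?_).2 hlim
    filter_upwards [eventually_gt_atTop 0] with T hT h
    exact absurd h (by positivity)
  · have hJ := hrun.integrable_param_comp (hv.measurable hv_meas hπ_meas hπ)
      fun ϑ' => hv.mem_Icc hπ ϑ'
    -- The average reward is the expected optimum minus the regret per round.
    have h := (tendsto_const_nhds (x := ∫ ω, J (θ ω) ∂P)).sub hregret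
    rw [sub_zero] at h
    refine h.congr' ?_
    filter_upwards [eventually_gt_atTop 0] with T hT
    have hT' : (T : ℝ) ≠ 0 := by positivity
    rw [BALSA.regret, integral_sub (hJ.const_mul _)
      (integrable_finsetSum _ fun t _ => hrun.integrable_reward t), integral_const_mul]
    field_simp
    ring
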